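/- **Theorem 3.1.** Let $a(n),b(n)\in\mathbb R$, $n\ge 1$, satisfy $(C+1)^{-1}\le a(n)\le C+1$ and $|b(n)|\le C$ for some $C>0$, and put $a(0)=1$. Let $J$ be the half line Jacobi matrix $$(Ju)(n)=a(n)u(n+1)+a(n-1)u(n-1)+b(n)u(n)\quad(n\ge 1),\qquad u(0)=0,$$ on $\ell_2(\{1,2,\ldots\})$, and let $E$ be its spectral resolution. A *Herglotz function* is a holomorphic map of $\mathbb C^+=\{z:\operatorname{Im}z>0\}$ to itself; $\mathcal H$ is the set of these. For $z\in\mathbb C^+$ let $f_\pm(n,z)$ be the solutions of $a(n)f(n+1)+a(n-1)f(n-1)+b(n)f(n)=zf(n)$ $(n\ge1)$ with $f_-(0,z)=0$, $f_-(1,z)=1$, $f_+(0,z)=1$, $f_+(1,z)=-\langle\delta_1,(J-z)^{-1}\delta_1\rangle$, and put $$m_\pm(n,z)=\mp\frac{f_\pm(n+1,z)}{a(n)f_\pm(n,z)},\qquad w_\pm^{(N)}(z)=\frac1N\sum_{n=1}^N\ln\bigl[a(n)m_\pm(n,z)\bigr],$$ where $\operatorname{Im}\ln\zeta\in(0,\pi)$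 for $\zeta\in\mathbb C^+$. Further let $$g_N(z)=\frac1N\sum_{n=1}^N\langle\delta_n,(J-z)^{-1}\delta_n\rangle,\quad d\nu_N(t)=\frac1N\sum_{n=1}^N d\|E(t)\delta_n\|^2,\quad dk_N=\frac1N\sum_{n=1}^N\delta_{\lambda_n^{(N)}},$$ where $\lambda_1^{(N)},\ldots,\lambda_N^{(N)}$ are the eigenvalues of $J$ on $\ell_2(\{1,\ldots,N\})$ with boundary conditions $u(0)=u(N+1)=0$. Fix a sequence of natural numbers $N_j\to\infty$, and consider the following statements: - (WP) $w_+^{(N_j)}\to w_+$ uniformly on compact subsets of $\mathbb C^+$, for some $w_+\in\mathcal H$. - (WM) $w_-^{(N_j)}\to w_-$ uniformly on compact subsets of $\mathbb C^+$, for some $w_-\in\mathcal H$. - (G) $g_{N_j}\to g$ uniformly on compact subsets of $\mathbb C^+$, for some $g\in\mathcal H$. - (N) $d\nu_{N_j}\to d\nu$ in weak $*$ sense, for some probability (Borel) measure $\nu$ on $\mathbb R$. - (K) $dk_{N_j}\to d\widetilde k$ in weak $*$ sense, for some probability (Borel) measure $d\widetilde k$ on $\mathbb R$. - (A) $(a(1)\cdots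 a(N_j))^{1/N_j}\to A$, for some $A>0$. Then (WP) $\iff$ (WM) and (G) $\iff$ (N) $\iff$ (K). Moreover, (WP) or (WM) implies (G), (N), (K) and also (A). Conversely, if (A) holds, then each of (G), (N), (K) implies (WP) and (WM). -/

import Mathlib

open Filter Topology MeasureTheory
open scoped ENNReal CompactlySupported ZeroAtInfty lp

noncomputable section

namespace JacobiDOS

/-! ### Herglotz functions and modes of convergence -/

/-- The open upper half plane, as a subset of `ℂ`. -/
def upperHalf : Set ℂ := {z | 0 < z.im}

/-- A Herglotz function: a holomorphic mapping of the upper half plane to itself.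
(Values outside the upper half plane are irrelevant.) -/
def IsHerglotz (F : ℂ → ℂ) : Prop :=
  DifferentiableOn ℂ F upperHalf ∧ Set.MapsTo F upperHalf upperHalf

/-- `F j → G` uniformly on compact subsets of the upper half plane. -/
def ConvOnCompacts (F : ℕ → ℂ → ℂ) (G : ℂ → ℂ) : Prop :=
  ∀ K : Set ℂ, IsCompact K → K ⊆ upperHalf → TendstoUniformlyOn F G atTop K

/-- Weak `*` convergence of measures on `ℝ`, where measures are viewed as functionals on the
space `C₀(ℝ, ℝ)` of continuous functions vanishing at infinity. -/
def ConvWeakStar (μ : ℕ → Measure ℝ) (ν : Measure ℝ) : Prop :=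
  ∀ f : C₀(ℝ, ℝ), Tendsto (fun j => ∫ t, f t ∂(μ j)) atTop (𝓝 (∫ t, f t ∂ν))

/-! ### Spectral measures of bounded self-adjoint operators -/

section SpectralMeasure

variable {H : Type*} [NormedAddCommGroup H] [InnerProductSpace ℂ H] [CompleteSpace H]

/-- The positive linear functional `f ↦ ⟨v, f(T) v⟩` on `C_c(ℝ, ℝ)`, where `f(T)` is defined by
the continuous functional calculus of the self-adjoint operator `T`. -/
def spectralFunctional (T : H →L[ℂ] H) (v : H) : C_c(ℝ, ℝ) →ₚ[ℝ] ℝ where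
  toFun f := (inner ℂ v ((cfc (fun t : ℝ => f t) T) v)).re
  map_add' f g := by
    have h : cfc (fun t : ℝ => (f + g) t) T
        = cfc (fun t : ℝ => f t) T + cfc (fun t : ℝ => g t) T :=
      cfc_add T (fun t : ℝ => f t) (fun t : ℝ => g t) f.continuous.continuousOn
        g.continuous.continuousOn
    rw [h]
    simp
  map_smul' c f := by
    have h : cfc (fun t : ℝ => (c • f) t) T = c • cfc (fun t : ℝ => f t) T :=
      cfc_smul c (fun t : ℝ => f t) T f.continuous.continuousOn
    rw [h]
    simp [inner_smul_right_eq_smul]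
  monotone' f g hfg := by
    have h : cfc (fun t : ℝ => f t) T ≤ cfc (fun t : ℝ => g t) T :=
      cfc_mono (fun t _ => hfg t) f.continuous.continuousOn g.continuous.continuousOn
    have h2 := ((ContinuousLinearMap.le_def _ _).1 h).re_inner_nonneg_right v
    simp only [sub_apply, inner_sub_right, map_sub, sub_nonneg] at h2
    exact h2

/-- The spectral measure `d‖E(t) v‖²` of the bounded self-adjoint operator `T = ∫ t dE(t)` and the
vector `v`: the regular Borel measure on `ℝ` representing `f ↦ ⟨v, f(T) v⟩`. -/
def spectralMeasure (T : H →L[ℂ] H) (v : H) : Measure ℝ :=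
  RealRMK.rieszMeasure (spectralFunctional T v)

theorem integral_spectralMeasure (T : H →L[ℂ] H) (v : H) (f : C_c(ℝ, ℝ)) :
    ∫ t, f t ∂(spectralMeasure T v) = (inner ℂ v ((cfc (fun t : ℝ => f t) T) v)).re :=
  RealRMK.integral_rieszMeasure _ f

end SpectralMeasure

/-! ### Half line Jacobi matrices -/

/-- Coefficients `a(n), b(n)`, `n ≥ 1`, of a half line Jacobi matrix, with
`(C+1)⁻¹ ≤ a(n) ≤ C+1` and `|b(n)| ≤ C` for some `C > 0`, and with the convention `a(0) = 1`.
The value `b 0` is never used. -/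
structure JacobiCoeff where
  a : ℕ → ℝ
  b : ℕ → ℝ
  a_zero : a 0 = 1
  bounds : ∃ C : ℝ, 0 < C ∧ ∀ n : ℕ, 1 ≤ n → (C + 1)⁻¹ ≤ a n ∧ a n ≤ C + 1 ∧ |b n| ≤ C

/-- A sequence on `{1, 2, …}` extended by `0` at the site `0`. -/
def extendZero (u : ℕ+ → ℂ) (n : ℕ) : ℂ := if h : 0 < n then u (n.toPNat h) else 0

/-- The unit vector `δ_n` of `ℓ²({1, 2, …})`. -/
def delta (n : ℕ+) : ℓ²(ℕ+, ℂ) := lp.single 2 n (1 : ℂ)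

theorem extendZero_comp_sq (u : ℓ²(ℕ+, ℂ)) (i : ℕ+ → ℕ) (hi : Function.Injective i) :
    Summable (fun n => ‖extendZero u (i n)‖ ^ 2) ∧
      ∑' n, ‖extendZero u (i n)‖ ^ 2 ≤ ‖u‖ ^ 2 := by
  have hs : HasSum (fun n : ℕ+ => ‖u n‖ ^ 2) (‖u‖ ^ 2) := by
    have := lp.hasSum_norm (p := 2) (by norm_num) u
    simpa using this
  have hs' : HasSum (fun k : ℕ => ‖extendZero u k‖ ^ 2) (‖u‖ ^ 2) := by
    have hinj : Function.Injective (fun n : ℕ+ => (n : ℕ)) := PNat.coe_injective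
    rw [← hinj.hasSum_iff]
    · convert hs using 2 with n
      simp only [Function.comp_apply, extendZero, n.pos, dite_true]
      rfl
    · intro k hk
      have : ¬ 0 < k := fun h => hk ⟨⟨k, h⟩, rfl⟩
      simp [extendZero, this]
  refine ⟨hs'.summable.comp_injective hi, ?_⟩
  rw [← hs'.tsum_eq]
  exact (hs'.summable.comp_injective hi).tsum_le_tsum_of_inj i hi (fun _ _ => by positivity)
    (fun _ => le_rfl) hs'.summable

namespace JacobiCoeff

variable (c : JacobiCoeff)

/-- `(Ju)(n) = a(n) u(n+1) + a(n-1) u(n-1) + b(n) u(n)` for `n ≥ 1`, with `u(0) = 0`. -/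
def action (u : ℕ+ → ℂ) (n : ℕ+) : ℂ :=
  c.a n * extendZero u ((n : ℕ) + 1) + c.a ((n : ℕ) - 1) * extendZero u ((n : ℕ) - 1)
    + c.b n * extendZero u n

theorem action_add (u v : ℕ+ → ℂ) : c.action (u + v) = c.action u + c.action v := by
  ext n
  simp only [action, extendZero, Pi.add_apply]
  split_ifs <;> ring

theorem action_smul (r : ℂ) (u : ℕ+ → ℂ) : c.action (r • u) = r • c.action u := by
  ext n
  simp only [action, extendZero, Pi.smul_apply, smul_eq_mul]
  split_ifs <;> ring

theorem action_bound : ∃ M : ℝ, 0 ≤ M ∧ ∀ u : ℓ²(ℕ+, ℂ),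
    Summable (fun n => ‖c.action u n‖ ^ 2) ∧
      ∑' n, ‖c.action u n‖ ^ 2 ≤ (M * ‖u‖) ^ 2 := by
  obtain ⟨C, hC, hb⟩ := c.bounds
  have ha : ∀ n : ℕ, ‖(c.a n : ℂ)‖ ≤ C + 1 := by
    intro n
    rw [Complex.norm_real, Real.norm_eq_abs]
    rcases Nat.eq_zero_or_pos n with rfl | hn
    · rw [c.a_zero]; norm_num; linarith
    · obtain ⟨h1, h2, -⟩ := hb n hn
      have : 0 < (C + 1)⁻¹ := by positivity
      rw [abs_of_pos (by linarith)]; exact h2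
  have hbb : ∀ n : ℕ+, ‖(c.b n : ℂ)‖ ≤ C + 1 := by
    intro n
    rw [Complex.norm_real, Real.norm_eq_abs]
    linarith [(hb n n.pos).2.2]
  refine ⟨3 * (C + 1), by positivity, fun u => ?_⟩
  obtain ⟨s1, t1⟩ := extendZero_comp_sq u (fun n => (n : ℕ) + 1)
    (fun m n h => PNat.coe_injective (by simpa using h))
  obtain ⟨s2, t2⟩ := extendZero_comp_sq u (fun n => (n : ℕ) - 1)
    (fun m n h => PNat.coe_injective (by have := m.pos; have := n.pos; simp at h; omega))
  obtain ⟨s3, t3⟩ := extendZero_comp_sq u (fun n => (n : ℕ)) PNat.coe_injective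
  have key : ∀ n : ℕ+, ‖c.action u n‖ ^ 2 ≤ 3 * (C + 1) ^ 2 *
      (‖extendZero u (n + 1)‖ ^ 2 + ‖extendZero u (n - 1)‖ ^ 2 + ‖extendZero u n‖ ^ 2) := by
    intro n
    have h : ‖c.action u n‖ ≤ (C + 1) *
        (‖extendZero u (n + 1)‖ + ‖extendZero u (n - 1)‖ + ‖extendZero u n‖) := by
      unfold action
      refine (norm_add₃_le).trans ?_
      rw [norm_mul, norm_mul, norm_mul, mul_add, mul_add]
      gcongr
      · exact ha n
      · exact ha _
      · exact hbb n
    have h2 : ‖c.action u n‖ ^ 2 ≤ ((C + 1) *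
        (‖extendZero u (n + 1)‖ + ‖extendZero u (n - 1)‖ + ‖extendZero u n‖)) ^ 2 := by
      gcongr
    refine h2.trans ?_
    rw [mul_pow, mul_comm (3 : ℝ), mul_assoc]
    gcongr
    nlinarith [sq_nonneg (‖extendZero u (n + 1)‖ - ‖extendZero u (n - 1)‖),
      sq_nonneg (‖extendZero u (n + 1)‖ - ‖extendZero u n‖),
      sq_nonneg (‖extendZero u (n - 1)‖ - ‖extendZero u n‖)]
  have hsum := ((s1.add s2).add s3).mul_left (3 * (C + 1) ^ 2)
  have hS : Summable (fun n => ‖c.action u n‖ ^ 2) :=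
    Summable.of_nonneg_of_le (fun _ => by positivity) key hsum
  refine ⟨hS, (hS.tsum_le_tsum key hsum).trans ?_⟩
  rw [tsum_mul_left, (s1.add s2).tsum_add s3, s1.tsum_add s2]
  calc 3 * (C + 1) ^ 2 * _ ≤ 3 * (C + 1) ^ 2 * (‖u‖ ^ 2 + ‖u‖ ^ 2 + ‖u‖ ^ 2) := by gcongr
    _ = (3 * (C + 1) * ‖u‖) ^ 2 := by ring

theorem action_memℓp (u : ℓ²(ℕ+, ℂ)) : Memℓp (c.action u) 2 := by
  obtain ⟨M, -, h⟩ := c.action_bound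
  refine memℓp_gen ?_
  simpa using (h u).1

/-- The half line Jacobi matrix `J` as a bounded operator on `ℓ²({1, 2, …})`. -/
def J : ℓ²(ℕ+, ℂ) →L[ℂ] ℓ²(ℕ+, ℂ) :=
  LinearMap.mkContinuousOfExistsBound
    { toFun := fun u => ⟨c.action u, c.action_memℓp u⟩
      map_add' := fun u v => lp.ext (c.action_add u v)
      map_smul' := fun r u => lp.ext (c.action_smul r u) }
    (by
      obtain ⟨M, hM, h⟩ := c.action_bound
      refine ⟨M, fun u => ?_⟩
      refine lp.norm_le_of_tsum_le (by norm_num) (by positivity) ?_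
      simpa using (h u).2)

/-- The resolvent `(J - z)⁻¹`. -/
def resolventJ (z : ℂ) : ℓ²(ℕ+, ℂ) →L[ℂ] ℓ²(ℕ+, ℂ) :=
  Ring.inverse (c.J - z • (1 : ℓ²(ℕ+, ℂ) →L[ℂ] ℓ²(ℕ+, ℂ)))

/-- The Green function `⟨δ_n, (J - z)⁻¹ δ_n⟩`. -/
def green (n : ℕ+) (z : ℂ) : ℂ := inner ℂ (delta n) (c.resolventJ z (delta n))

/-- The Titchmarsh-Weyl function `m_+(z) = ⟨δ_1, (J - z)⁻¹ δ_1⟩`. -/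
def weylM (z : ℂ) : ℂ := c.green 1 z

/-- The solution of `a(n) f(n+1) + a(n-1) f(n-1) + b(n) f(n) = z f(n)`, `n ≥ 1`, with
given initial values `f(0) = f₀`, `f(1) = f₁`. -/
def solution (z f₀ f₁ : ℂ) : ℕ → ℂ
  | 0 => f₀
  | 1 => f₁
  | n + 2 => ((z - c.b (n + 1)) * solution z f₀ f₁ (n + 1) - c.a n * solution z f₀ f₁ n)
      / c.a (n + 1)

/-- The solution `f_+(n, z)`, with `f_+(0, z) = 1`, `f_+(1, z) = -m_+(z)`. -/
def fPlus (n : ℕ) (z : ℂ) : ℂ := c.solution z 1 (-c.weylM z) n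

/-- The solution `f_-(n, z)`, with `f_-(0, z) = 0`, `f_-(1, z) = 1`. -/
def fMinus (n : ℕ) (z : ℂ) : ℂ := c.solution z 0 1 n

/-- `m_+(n, z) = -f_+(n+1, z) / (a(n) f_+(n, z))`. -/
def mPlus (n : ℕ) (z : ℂ) : ℂ := -(c.fPlus (n + 1) z / (c.a n * c.fPlus n z))

/-- `m_-(n, z) = f_-(n+1, z) / (a(n) f_-(n, z))`. -/
def mMinus (n : ℕ) (z : ℂ) : ℂ := c.fMinus (n + 1) z / (c.a n * c.fMinus n z)

/-- `w_+^{(N)}(z) = (1/N) ∑_{n=1}^N ln [a(n) m_+(n, z)]`; on the upper half plane the principal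
branch of the logarithm is the one with imaginary part in `(0, π)`. -/
def wPlus (N : ℕ) (z : ℂ) : ℂ :=
  (1 / (N : ℂ)) * ∑ n ∈ Finset.Icc 1 N, Complex.log (c.a n * c.mPlus n z)

/-- `w_-^{(N)}(z) = (1/N) ∑_{n=1}^N ln [a(n) m_-(n, z)]`. -/
def wMinus (N : ℕ) (z : ℂ) : ℂ :=
  (1 / (N : ℂ)) * ∑ n ∈ Finset.Icc 1 N, Complex.log (c.a n * c.mMinus n z)

/-- `g_N(z) = (1/N) ∑_{n=1}^N ⟨δ_n, (J - z)⁻¹ δ_n⟩`. -/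
def gN (N : ℕ) (z : ℂ) : ℂ :=
  (1 / (N : ℂ)) * ∑ i ∈ Finset.range N, c.green i.succPNat z

/-- `dν_N = (1/N) ∑_{n=1}^N d‖E(t) δ_n‖²`, with `E` the spectral resolution of `J`. -/
def nuN (N : ℕ) : Measure ℝ :=
  (N : ℝ≥0∞)⁻¹ • ∑ i ∈ Finset.range N, spectralMeasure c.J (delta i.succPNat)

/-- The matrix of `J` on `ℓ²({1, …, N})` with boundary conditions `u(0) = u(N+1) = 0`; the
index `i : Fin N` stands for the site `i + 1`. -/
def truncation (N : ℕ) : Matrix (Fin N) (Fin N) ℝ :=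
  Matrix.of fun i k =>
    if (i : ℕ) = (k : ℕ) then c.b ((i : ℕ) + 1)
    else if (k : ℕ) = (i : ℕ) + 1 then c.a ((i : ℕ) + 1)
    else if (i : ℕ) = (k : ℕ) + 1 then c.a ((k : ℕ) + 1)
    else 0

theorem truncation_isHermitian (N : ℕ) : (c.truncation N).IsHermitian := by
  ext i k
  simp only [truncation, Matrix.conjTranspose_apply, Matrix.of_apply, star_trivial]
  split_ifs <;> first | rfl | omega | simp_all

/-- The eigenvalue counting measure `dk_N = (1/N) ∑_{n=1}^N δ_{λ_n^{(N)}}`, where the `λ_n^{(N)}`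
are the eigenvalues of `J` on `ℓ²({1, …, N})`. -/
def kN (N : ℕ) : Measure ℝ :=
  (N : ℝ≥0∞)⁻¹ • ∑ i : Fin N, Measure.dirac ((c.truncation_isHermitian N).eigenvalues i)

/-! ### The six conditions -/

/-- `w_+^{(N_j)}` converges, uniformly on compact sets, to a Herglotz function. -/
def CondWP (N : ℕ → ℕ) : Prop :=
  ∃ w : ℂ → ℂ, IsHerglotz w ∧ ConvOnCompacts (fun j => c.wPlus (N j)) w

/-- `w_-^{(N_j)}` converges, uniformly on compact sets, to a Herglotz function. -/
def CondWM (N : ℕ → ℕ) : Prop :=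
  ∃ w : ℂ → ℂ, IsHerglotz w ∧ ConvOnCompacts (fun j => c.wMinus (N j)) w

/-- `g_{N_j}` converges, uniformly on compact sets, to a Herglotz function. -/
def CondG (N : ℕ → ℕ) : Prop :=
  ∃ g : ℂ → ℂ, IsHerglotz g ∧ ConvOnCompacts (fun j => c.gN (N j)) g

/-- `dν_{N_j}` converges in weak `*` sense to a probability measure. -/
def CondN (N : ℕ → ℕ) : Prop :=
  ∃ ν : Measure ℝ, IsProbabilityMeasure ν ∧ ConvWeakStar (fun j => c.nuN (N j)) ν

/-- `dk_{N_j}` converges in weak `*` sense to a probability measure. -/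
def CondK (N : ℕ → ℕ) : Prop :=
  ∃ k : Measure ℝ, IsProbabilityMeasure k ∧ ConvWeakStar (fun j => c.kN (N j)) k

/-- `(a(1) ⋯ a(N_j))^{1/N_j}` converges to a positive number. -/
def CondA (N : ℕ → ℕ) : Prop :=
  ∃ A : ℝ, 0 < A ∧
    Tendsto (fun j => (∏ n ∈ Finset.Icc 1 (N j), c.a n) ^ (1 / (N j : ℝ))) atTop (𝓝 A)

end JacobiCoeff

end JacobiDOS

end

namespace JacobiDOS

/-! Every condition is compared with one statement about eigenvalues: the Stieltjes transforms of
$dk_{N_j}$ converge pointwise on $\mathbb C^+$. (G), (N) and (K) are each equivalent to it, and (WM)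
amounts to it together with (A).

(WP) and (WM). Constancy of the Wronskian gives
$G(n)=\langle\delta_n,(J-z)^{-1}\delta_n\rangle=-f_-(n)f_+(n)$, hence $a(n)m_+(n)\cdot
a(n)m_-(n)=-G(n+1)/G(n)$. With logarithms in the strip $(0,\pi)$ the sum telescopes
(`wPlus_add_wMinus`): $w_+^{(N)}+w_-^{(N)}=\pi i+O(1/N)$ uniformly on compacts, because $\ln G$ is
bounded there uniformly in the site.

(G), (N) and (K). The transform of $\nu_N$ is $g_N$. Since $f_-(N+1,\cdot)$ is a multiple of the
characteristic polynomial of the truncation, the transform of $k_N$ is $-\frac1N(\ln f_-(N+1))'$. A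
Christoffel-Darboux identity (`sum_fMinus_mul_fPlus`) shows that the two differ by a bounded
boundary term divided by $N$. All measures sit in fixed compact intervals, so pointwise convergence
of transforms is the same as weak $*$ convergence to a probability measure: resolvents determine
moments, moments determine integrals of continuous functions, and tightness provides the limit
measure.

The role of (A). The Thouless formula (`wMinus_eq_sum_log`) reads
$w_-^{(N)}(z)=\int\ln(z-t)\,dk_N(t)-\frac1N\sum_{n\le N}\ln a(n)$. Differentiating it yields
convergence of the transforms from (WM); once $k_{N_j}$ converges the integral converges, so
$w_-^{(N_j)}$ converges exactly when the mean of $\ln a$ does.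

Limits are Herglotz automatically: the transform of a probability measure has positive imaginary
part, and $\operatorname{Im}w_-^{(N)}(z)$ stays away from $0$ and $\pi$ uniformly in $N$. -/

theorem isOpen_upperHalf : IsOpen upperHalf := isOpen_lt continuous_const Complex.continuous_im

/-! ### Stieltjes transforms of measures on the line -/

theorem ofReal_sub_ne_zero {z : ℂ} (hz : z ∈ upperHalf) (t : ℝ) : (t : ℂ) - z ≠ 0 := by
  intro h
  have h2 := congrArg Complex.im h
  have : 0 < z.im := hz
  simp at h2
  linarith

theorem im_le_norm_ofReal_sub {z : ℂ} (hz : z ∈ upperHalf) (t : ℝ) : z.im ≤ ‖(t : ℂ) - z‖ := by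
  have h : |((t : ℂ) - z).im| ≤ ‖(t : ℂ) - z‖ := Complex.abs_im_le_norm _
  have h0 : 0 < z.im := hz
  simpa [abs_of_pos h0] using h

theorem norm_inv_ofReal_sub_le {z : ℂ} (hz : z ∈ upperHalf) (t : ℝ) :
    ‖((t : ℂ) - z)⁻¹‖ ≤ (z.im)⁻¹ := by
  rw [norm_inv]
  exact inv_anti₀ hz (im_le_norm_ofReal_sub hz t)

theorem continuous_inv_ofReal_sub {z : ℂ} (hz : z ∈ upperHalf) :
    Continuous fun t : ℝ => ((t : ℂ) - z)⁻¹ :=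
  Continuous.inv₀ (by fun_prop) (ofReal_sub_ne_zero hz)

/-- The Stieltjes transform `z ↦ ∫ (t - z)⁻¹ dμ(t)`. -/
noncomputable def stieltjes (μ : Measure ℝ) (z : ℂ) : ℂ := ∫ t : ℝ, ((t : ℂ) - z)⁻¹ ∂μ

section Stieltjes

variable {μ : Measure ℝ}

theorem integrable_inv_ofReal_sub [IsFiniteMeasure μ] {z : ℂ} (hz : z ∈ upperHalf) :
    Integrable (fun t : ℝ => ((t : ℂ) - z)⁻¹) μ :=
  Integrable.of_bound (continuous_inv_ofReal_sub hz).aestronglyMeasurable (z.im)⁻¹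
    (Eventually.of_forall (norm_inv_ofReal_sub_le hz))

theorem norm_stieltjes_le [IsProbabilityMeasure μ] {z : ℂ} (hz : z ∈ upperHalf) :
    ‖stieltjes μ z‖ ≤ (z.im)⁻¹ := by
  simpa [stieltjes] using norm_integral_le_of_norm_le_const (μ := μ)
    (Eventually.of_forall (norm_inv_ofReal_sub_le hz))

/-- Resolvent identity. The constant does not depend on the measure; this is the equicontinuity that
turns pointwise into locally uniform convergence. -/
theorem norm_stieltjes_sub_le [IsProbabilityMeasure μ] {ε : ℝ} (hε : 0 < ε) {z w : ℂ}
    (hz : ε ≤ z.im) (hw : ε ≤ w.im) :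
    ‖stieltjes μ z - stieltjes μ w‖ ≤ (ε ^ 2)⁻¹ * ‖z - w‖ := by
  have hz' : z ∈ upperHalf := hε.trans_le hz
  have hw' : w ∈ upperHalf := hε.trans_le hw
  unfold stieltjes
  rw [← integral_sub (integrable_inv_ofReal_sub hz') (integrable_inv_ofReal_sub hw')]
  have : ∀ t : ℝ, ‖((t : ℂ) - z)⁻¹ - ((t : ℂ) - w)⁻¹‖ ≤ (ε ^ 2)⁻¹ * ‖z - w‖ := by
    intro t
    have h : ((t : ℂ) - z)⁻¹ - ((t : ℂ) - w)⁻¹ = ((t : ℂ) - z)⁻¹ * ((t : ℂ) - w)⁻¹ * (z - w) := by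
      have h1 := ofReal_sub_ne_zero hz' t
      have h2 := ofReal_sub_ne_zero hw' t
      field_simp
      ring
    rw [h, norm_mul, norm_mul]
    have h1 := (norm_inv_ofReal_sub_le hz' t).trans (inv_anti₀ hε hz)
    have h2 := (norm_inv_ofReal_sub_le hw' t).trans (inv_anti₀ hε hw)
    calc _ ≤ ε⁻¹ * ε⁻¹ * ‖z - w‖ := by gcongr
      _ = _ := by rw [← mul_inv, sq]
  simpa using norm_integral_le_of_norm_le_const (μ := μ) (Eventually.of_forall this)

theorem differentiableOn_stieltjes [IsFiniteMeasure μ] :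
    DifferentiableOn ℂ (stieltjes μ) upperHalf := by
  intro z hz
  have hz0 : 0 < z.im := hz
  have hball : ∀ w ∈ Metric.ball z (z.im / 2), z.im / 2 ≤ w.im := by
    intro w hw
    have h1 : |(w - z).im| ≤ ‖w - z‖ := Complex.abs_im_le_norm _
    rw [Metric.mem_ball, dist_eq_norm] at hw
    have := (abs_le.1 (h1.trans hw.le)).1
    simp at this
    linarith
  have hball' : ∀ w ∈ Metric.ball z (z.im / 2), w ∈ upperHalf :=
    fun w hw => (half_pos hz0).trans_le (hball w hw)
  have key := hasDerivAt_integral_of_dominated_loc_of_deriv_le (μ := μ)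
    (F := fun (w : ℂ) (t : ℝ) => ((t : ℂ) - w)⁻¹)
    (F' := fun (w : ℂ) (t : ℝ) => (((t : ℂ) - w)⁻¹) ^ 2)
    (x₀ := z) (s := Metric.ball z (z.im / 2))
    (bound := fun _ => ((z.im / 2)⁻¹) ^ 2)
    (Metric.ball_mem_nhds z (half_pos hz0))
    (by
      filter_upwards [Metric.ball_mem_nhds z (half_pos hz0)] with w hw
      exact (continuous_inv_ofReal_sub (hball' w hw)).aestronglyMeasurable)
    (integrable_inv_ofReal_sub hz)
    ((continuous_inv_ofReal_sub hz).pow 2).aestronglyMeasurable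
    (Eventually.of_forall fun t w hw => by
      rw [norm_pow]
      gcongr
      exact (norm_inv_ofReal_sub_le (hball' w hw) t).trans
        (inv_anti₀ (half_pos hz0) (hball w hw)))
    (integrable_const _)
    (Eventually.of_forall fun t w hw => by
      have h := ((hasDerivAt_id w).const_sub (t : ℂ)).inv (ofReal_sub_ne_zero (hball' w hw) t)
      have h' : - -1 / ((t : ℂ) - id w) ^ 2 = (((t : ℂ) - w)⁻¹) ^ 2 := by
        rw [neg_neg, one_div, inv_pow, id]
      rw [h'] at h
      exact h)
  exact key.2.differentiableAt.differentiableWithinAt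

theorem im_inv_ofReal_sub (z : ℂ) (t : ℝ) :
    (((t : ℂ) - z)⁻¹).im = z.im / Complex.normSq ((t : ℂ) - z) := by
  rw [Complex.inv_im]; simp

/-- For a measure carried by $[-M,M]$ one has $|t-z|\le M+|z|$ almost everywhere. The bound is
uniform over such measures and later keeps the logarithms of all Green functions bounded. -/
theorem le_im_stieltjes [IsProbabilityMeasure μ] {M : ℝ} (hM : μ (Set.Icc (-M) M)ᶜ = 0) {z : ℂ}
    (hz : z ∈ upperHalf) : z.im / (M + ‖z‖) ^ 2 ≤ (stieltjes μ z).im := by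
  have hz0 : 0 < z.im := hz
  have h1 : (stieltjes μ z).im = ∫ t : ℝ, (((t : ℂ) - z)⁻¹).im ∂μ := by
    simpa [stieltjes] using (integral_im (integrable_inv_ofReal_sub (μ := μ) hz)).symm
  have h2 : ∫ _ : ℝ, z.im / (M + ‖z‖) ^ 2 ∂μ = z.im / (M + ‖z‖) ^ 2 := by simp
  rw [h1, ← h2]
  have hi := (integrable_inv_ofReal_sub (μ := μ) hz).im
  refine integral_mono_ae (integrable_const _) hi ?_
  have hae : ∀ᵐ t ∂μ, t ∈ Set.Icc (-M) M := hM
  filter_upwards [hae] with t ht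
  change _ ≤ (((t : ℂ) - z)⁻¹).im
  rw [im_inv_ofReal_sub, Complex.normSq_eq_norm_sq]
  have h3 : 0 < ‖(t : ℂ) - z‖ := hz0.trans_le (im_le_norm_ofReal_sub hz t)
  gcongr
  refine (norm_sub_le _ _).trans ?_
  gcongr
  rw [Complex.norm_real, Real.norm_eq_abs]
  exact abs_le.2 ht

/-- Without a support bound there is no quantitative estimate, but the integrand is positive
everywhere. This is the form needed for weak limits. -/
theorem im_stieltjes_pos [IsProbabilityMeasure μ] {z : ℂ}
    (hz : z ∈ upperHalf) : 0 < (stieltjes μ z).im := by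
  have hz0 : 0 < z.im := hz
  have h1 : (stieltjes μ z).im = ∫ t : ℝ, (((t : ℂ) - z)⁻¹).im ∂μ := by
    simpa [stieltjes] using (integral_im (integrable_inv_ofReal_sub (μ := μ) hz)).symm
  have hpos : ∀ t : ℝ, 0 < (((t : ℂ) - z)⁻¹).im := fun t => by
    rw [im_inv_ofReal_sub]
    exact div_pos hz0 (Complex.normSq_pos.2 (ofReal_sub_ne_zero hz t))
  rw [h1, integral_pos_iff_support_of_nonneg (fun t => (hpos t).le)
    (integrable_inv_ofReal_sub (μ := μ) hz).im]
  have : Function.support (fun t : ℝ => (((t : ℂ) - z)⁻¹).im) = Set.univ :=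
    Set.eq_univ_of_forall fun t => (hpos t).ne'
  rw [this]
  simp

theorem isHerglotz_stieltjes [IsProbabilityMeasure μ] : IsHerglotz (stieltjes μ) :=
  ⟨differentiableOn_stieltjes, fun _ hz => im_stieltjes_pos hz⟩

end Stieltjes

/-! ### Locally uniform convergence and weak convergence -/

theorem exists_pos_le_im_of_isCompact {K : Set ℂ} (hK : IsCompact K) (hKU : K ⊆ upperHalf) :
    ∃ ε : ℝ, 0 < ε ∧ ∀ z ∈ K, ε ≤ z.im := by
  rcases K.eq_empty_or_nonempty with rfl | hne
  · exact ⟨1, one_pos, by simp⟩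
  · obtain ⟨z, hz, hmin⟩ := hK.exists_isMinOn hne Complex.continuous_im.continuousOn
    exact ⟨z.im, hKU hz, fun w hw => hmin hw⟩

/-- Pointwise convergence on the upper half plane, together with a uniform Lipschitz bound on
every half plane `ε ≤ Im z`, implies uniform convergence on compact sets. -/
theorem convOnCompacts_of_lipschitz {F : ℕ → ℂ → ℂ} {G : ℂ → ℂ}
    (hF : ∀ ε > 0, ∃ L : ℝ, ∀ᶠ j in atTop, ∀ z w : ℂ, ε ≤ z.im → ε ≤ w.im →
      ‖F j z - F j w‖ ≤ L * ‖z - w‖)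
    (hG : ∀ z ∈ upperHalf, Tendsto (fun j => F j z) atTop (𝓝 (G z))) :
    ConvOnCompacts F G := by
  intro K hK hKU
  obtain ⟨ε, hε, hKε⟩ := exists_pos_le_im_of_isCompact hK hKU
  obtain ⟨L, hL⟩ := hF ε hε
  have hGL : ∀ z w : ℂ, ε ≤ z.im → ε ≤ w.im → ‖G z - G w‖ ≤ L * ‖z - w‖ := fun z w hz hw =>
    le_of_tendsto ((hG z (hε.trans_le hz)).sub (hG w (hε.trans_le hw))).norm
      (hL.mono fun j hj => hj z w hz hw)
  rw [Metric.tendstoUniformlyOn_iff]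
  intro η hη
  -- The mesh makes each of the two Lipschitz errors at most η / 3; `|L| + 1` guards against `L ≤
  -- 0`.
  have hδ : 0 < η / (3 * (|L| + 1)) := by positivity
  set δ := η / (3 * (|L| + 1)) with hδdef
  obtain ⟨s, hsK, hsfin, hcov⟩ := hK.finite_cover_balls hδ
  have hconv : ∀ᶠ j in atTop, ∀ w ∈ s, ‖F j w - G w‖ < η / 3 := by
    rw [hsfin.eventually_all]
    intro w hw
    have := Metric.tendsto_nhds.1 (hG w (hKU (hsK hw))) (η / 3) (by positivity)
    simpa [dist_eq_norm] using this
  filter_upwards [hconv, hL] with j hj hLj z hz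
  obtain ⟨w, hw, hzw⟩ := Set.mem_iUnion₂.1 (hcov hz)
  rw [Metric.mem_ball, dist_eq_norm] at hzw
  have hLδ : L * ‖z - w‖ ≤ η / 3 := by
    calc L * ‖z - w‖ ≤ (|L| + 1) * δ := by
          gcongr
          linarith [le_abs_self L]
      _ = η / 3 := by rw [hδdef]; field_simp
  have h1 := hLj z w (hKε z hz) (hKε w (hsK hw))
  have h2 := hGL z w (hKε z hz) (hKε w (hsK hw))
  have h3 := hj w hw
  rw [dist_eq_norm]
  have h4 : G z - F j z = (G z - G w) - (F j w - G w) - (F j z - F j w) := by ring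
  rw [h4]
  calc _ ≤ ‖G z - G w‖ + ‖F j w - G w‖ + ‖F j z - F j w‖ :=
        (norm_sub_le _ _).trans (by gcongr; exact norm_sub_le _ _)
    _ < η := by linarith

theorem ConvOnCompacts.tendsto {F : ℕ → ℂ → ℂ} {G : ℂ → ℂ} (h : ConvOnCompacts F G) {z : ℂ}
    (hz : z ∈ upperHalf) : Tendsto (fun j => F j z) atTop (𝓝 (G z)) :=
  (h {z} isCompact_singleton (Set.singleton_subset_iff.2 hz)).tendsto_at rfl

theorem ConvOnCompacts.tendstoLocallyUniformlyOn {F : ℕ → ℂ → ℂ} {G : ℂ → ℂ}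
    (h : ConvOnCompacts F G) : TendstoLocallyUniformlyOn F G atTop upperHalf :=
  (tendstoLocallyUniformlyOn_iff_forall_isCompact isOpen_upperHalf).2 fun K hK hc => h K hc hK

/-- A probability measure on `ℝ` carried by `[-M, M]`. -/
def IsProbOn (M : ℝ) (μ : Measure ℝ) : Prop :=
  IsProbabilityMeasure μ ∧ μ (Set.Icc (-M) M)ᶜ = 0

namespace IsProbOn

variable {M : ℝ} {μ : Measure ℝ}

theorem ae_mem (h : IsProbOn M μ) : ∀ᵐ t ∂μ, t ∈ Set.Icc (-M) M := h.2

theorem integrable {E : Type*} [NormedAddCommGroup E] (h : IsProbOn M μ) {f : ℝ → E}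
    (hf : ContinuousOn f (Set.Icc (-M) M)) : Integrable f μ := by
  have := h.1
  have h2 : μ.restrict (Set.Icc (-M) M) = μ := Measure.restrict_eq_self_of_ae_mem h.ae_mem
  rw [← h2]
  exact hf.integrableOn_compact isCompact_Icc

end IsProbOn

/-- Convergence of the integrals of `f` along a sequence of measures. -/
def IntegralConv (μ : ℕ → Measure ℝ) (f : ℝ → ℂ) : Prop :=
  ∃ l : ℂ, Tendsto (fun j => ∫ t, f t ∂(μ j)) atTop (𝓝 l)

section WeakConvergence

variable {M : ℝ} {μ : ℕ → Measure ℝ}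

theorem IntegralConv.add (hμ : ∀ᶠ j in atTop, IsProbOn M (μ j)) {f g : ℝ → ℂ}
    (hf : ContinuousOn f (Set.Icc (-M) M)) (hg : ContinuousOn g (Set.Icc (-M) M))
    (h1 : IntegralConv μ f) (h2 : IntegralConv μ g) :
    IntegralConv μ fun t => f t + g t := by
  obtain ⟨l, hl⟩ := h1
  obtain ⟨l', hl'⟩ := h2
  exact ⟨l + l', (hl.add hl').congr' (hμ.mono fun j hj =>
    (integral_add (hj.integrable hf) (hj.integrable hg)).symm)⟩

theorem IntegralConv.const_mul {f : ℝ → ℂ} (h : IntegralConv μ f) (c : ℂ) :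
    IntegralConv μ fun t => c * f t := by
  obtain ⟨l, hl⟩ := h
  exact ⟨c * l, (hl.const_mul c).congr fun j => (integral_const_mul c f).symm⟩

theorem integralConv_sum (hμ : ∀ᶠ j in atTop, IsProbOn M (μ j)) {ι : Type*} (s : Finset ι)
    {f : ι → ℝ → ℂ} (hf : ∀ i ∈ s, ContinuousOn (f i) (Set.Icc (-M) M))
    (h : ∀ i ∈ s, IntegralConv μ (f i)) :
    IntegralConv μ fun t => ∑ i ∈ s, f i t := by
  choose! l hl using h
  exact ⟨∑ i ∈ s, l i, (tendsto_finsetSum s hl).congr' (hμ.mono fun j hj =>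
    (integral_finsetSum s fun i hi => hj.integrable (hf i hi)).symm)⟩

/-- The measures have mass one on a common interval, so uniform approximation of `f` there
approximates its integrals uniformly in `j`: the functions with convergent integrals are closed
under uniform limits. -/
theorem integralConv_of_approx (hμ : ∀ᶠ j in atTop, IsProbOn M (μ j)) {f : ℝ → ℂ}
    (hf : ContinuousOn f (Set.Icc (-M) M))
    (h : ∀ ε > 0, ∃ g : ℝ → ℂ, ContinuousOn g (Set.Icc (-M) M) ∧ IntegralConv μ g ∧
      ∀ t ∈ Set.Icc (-M) M, ‖f t - g t‖ ≤ ε) : IntegralConv μ f := by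
  refine cauchySeq_tendsto_of_complete (Metric.cauchySeq_iff.2 fun ε hε => ?_)
  obtain ⟨g, hg, ⟨l, hl⟩, hfg⟩ := h (ε / 4) (by positivity)
  have h1 : ∀ᶠ j in atTop, dist (∫ t, f t ∂(μ j)) l < ε / 2 := by
    filter_upwards [hμ, Metric.tendsto_nhds.1 hl (ε / 4) (by positivity)] with j hj hjl
    have := hj.1
    have h2 : dist (∫ t, f t ∂(μ j)) (∫ t, g t ∂(μ j)) ≤ ε / 4 := by
      rw [dist_eq_norm, ← integral_sub (hj.integrable hf) (hj.integrable hg)]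
      simpa using norm_integral_le_of_norm_le_const (μ := μ j) (hj.ae_mem.mono hfg)
    linarith [dist_triangle (∫ t, f t ∂(μ j)) (∫ t, g t ∂(μ j)) l]
  obtain ⟨n, hn⟩ := eventually_atTop.1 h1
  refine ⟨n, fun i hi k hk => ?_⟩
  linarith [dist_triangle_right (∫ t, f t ∂(μ i)) (∫ t, f t ∂(μ k)) l, hn i hi, hn k hk]

/-- Tail of the geometric series of $-z/(t-z)=\sum_k(t/z)^k$: up to an error $t^{p+1}/(t-z)$, the
power $t^p$ is a combination of one resolvent and lower powers. -/
theorem geom_remainder {z t : ℂ} (hz : z ≠ 0) (hzt : t - z ≠ 0) (p : ℕ) :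
    t ^ p - z ^ p * ((-z) * (t - z)⁻¹ + ∑ k ∈ Finset.range p, -(z⁻¹ ^ k) * t ^ k)
      = t ^ (p + 1) * (t - z)⁻¹ := by
  have h1 : ∑ k ∈ Finset.range p, -(z⁻¹ ^ k) * t ^ k = -∑ k ∈ Finset.range p, (t / z) ^ k := by
    rw [← Finset.sum_neg_distrib]
    refine Finset.sum_congr rfl fun k _ => ?_
    rw [div_eq_mul_inv, mul_pow]; ring
  have hne : t / z ≠ 1 := fun h => hzt (by rw [div_eq_one_iff_eq hz] at h; rw [h, sub_self])
  rw [h1, geom_sum_eq hne, div_pow]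
  have h2 : t / z - 1 ≠ 0 := sub_ne_zero.2 hne
  field_simp
  have h3 : z ^ p ≠ 0 := pow_ne_zero _ hz
  ring

/-- Strong induction on the power: `geom_remainder` at a point high on the imaginary axis reduces
the `p`-th moment to a Stieltjes transform and lower moments. -/
theorem integralConv_pow (hμ : ∀ᶠ j in atTop, IsProbOn M (μ j))
    (hS : ∀ z ∈ upperHalf, ∃ l, Tendsto (fun j => stieltjes (μ j) z) atTop (𝓝 l)) (p : ℕ) :
    IntegralConv μ fun t => (t : ℂ) ^ p := by
  induction p using Nat.strong_induction_on with
  | _ p ih =>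
    refine integralConv_of_approx hμ (by fun_prop) fun ε hε => ?_
    -- The remainder is at most $|M|^{p+1}/y$; the `+ 1` keeps $y$ positive when $M=0$.
    set y : ℝ := (|M| ^ (p + 1) + 1) / ε with hy
    have hy0 : 0 < y := by positivity
    have hzim : (Complex.I * y).im = y := by simp
    have hz : Complex.I * y ∈ upperHalf := by
      change 0 < (Complex.I * y).im
      rwa [hzim]
    set z : ℂ := Complex.I * y with hzdef
    have hz0 : z ≠ 0 := by
      intro h
      rw [h] at hzim
      simp at hzim
      linarith
    have hc := continuous_inv_ofReal_sub hz
    refine ⟨fun t => z ^ p * ((-z) * ((t : ℂ) - z)⁻¹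
      + ∑ k ∈ Finset.range p, -(z⁻¹ ^ k) * (t : ℂ) ^ k), by fun_prop, ?_, ?_⟩
    · refine IntegralConv.const_mul (IntegralConv.add hμ
        (hc.const_mul _).continuousOn (by fun_prop)
        (IntegralConv.const_mul (hS z hz) _) (integralConv_sum hμ _ (fun _ _ => by fun_prop)
          fun k hk => IntegralConv.const_mul (ih k (Finset.mem_range.1 hk)) _)) _
    · intro t ht
      rw [geom_remainder hz0 (ofReal_sub_ne_zero hz t), norm_mul, norm_pow, Complex.norm_real,
        Real.norm_eq_abs]
      have h1 := norm_inv_ofReal_sub_le hz t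
      rw [hzim] at h1
      have h2 : |t| ≤ |M| := (abs_le.2 ht).trans (le_abs_self M)
      calc |t| ^ (p + 1) * ‖((t : ℂ) - z)⁻¹‖ ≤ (|M| ^ (p + 1) + 1) * y⁻¹ := by
            gcongr
            exact (pow_le_pow_left₀ (abs_nonneg t) h2 _).trans (by linarith)
        _ = ε := by rw [hy]; field_simp

theorem integralConv_polynomial (hμ : ∀ᶠ j in atTop, IsProbOn M (μ j))
    (hS : ∀ z ∈ upperHalf, ∃ l, Tendsto (fun j => stieltjes (μ j) z) atTop (𝓝 l))
    (p : Polynomial ℝ) : IntegralConv μ fun t => ((p.eval t : ℝ) : ℂ) := by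
  have h := integralConv_sum hμ (Finset.range (p.natDegree + 1))
    (f := fun k t => (p.coeff k : ℂ) * (t : ℂ) ^ k) (fun _ _ => by fun_prop)
    (fun k _ => (integralConv_pow hμ hS k).const_mul _)
  convert h using 2 with t
  rw [Polynomial.eval_eq_sum_range]
  push_cast
  rfl

theorem exists_tendsto_integral (hμ : ∀ᶠ j in atTop, IsProbOn M (μ j))
    (hS : ∀ z ∈ upperHalf, ∃ l, Tendsto (fun j => stieltjes (μ j) z) atTop (𝓝 l))
    {f : ℝ → ℝ} (hf : ContinuousOn f (Set.Icc (-M) M)) :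
    ∃ l : ℝ, Tendsto (fun j => ∫ t, f t ∂(μ j)) atTop (𝓝 l) := by
  have hfc : ContinuousOn (fun t => (f t : ℂ)) (Set.Icc (-M) M) :=
    Complex.continuous_ofReal.comp_continuousOn hf
  obtain ⟨l, hl⟩ : IntegralConv μ fun t => (f t : ℂ) := by
    refine integralConv_of_approx hμ hfc fun ε hε => ?_
    obtain ⟨p, hp⟩ := exists_polynomial_near_of_continuousOn _ _ f hf ε hε
    refine ⟨fun t => ((p.eval t : ℝ) : ℂ), ?_, integralConv_polynomial hμ hS p, fun t ht => ?_⟩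
    · exact (Complex.continuous_ofReal.comp p.continuous).continuousOn
    · rw [← Complex.ofReal_sub, Complex.norm_real, Real.norm_eq_abs, abs_sub_comm]
      exact (hp t ht).le
  refine ⟨l.re, ((Complex.continuous_re.tendsto l).comp hl).congr fun j => ?_⟩
  change (∫ t, ((f t : ℝ) : ℂ) ∂(μ j)).re = _
  rw [integral_complex_ofReal, Complex.ofReal_re]

/-- Prokhorov: the interval itself witnesses tightness. -/
theorem isCompact_closure_isProbOn (M : ℝ) :
    IsCompact (closure {μ : ProbabilityMeasure ℝ | IsProbOn M (μ : Measure ℝ)}) := by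
  refine isCompact_closure_of_isTightMeasureSet
    (isTightMeasureSet_iff_exists_isCompact_measure_compl_le.2 fun ε _ =>
      ⟨Set.Icc (-M) M, isCompact_Icc, ?_⟩)
  rintro _ ⟨μ, hμ, rfl⟩
  rw [hμ.2]
  exact zero_le

/-- If the Stieltjes transforms converge pointwise, the measures converge. -/
theorem exists_convWeakStar (hμ : ∀ᶠ j in atTop, IsProbOn M (μ j))
    (hS : ∀ z ∈ upperHalf, ∃ l, Tendsto (fun j => stieltjes (μ j) z) atTop (𝓝 l)) :
    ∃ ν : Measure ℝ, IsProbabilityMeasure ν ∧ ConvWeakStar μ ν := by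
  classical
  obtain ⟨n, hn⟩ := eventually_atTop.1 hμ
  -- Early terms, which need not be probability measures, are replaced by the `n`-th one.
  let μ' : ℕ → ProbabilityMeasure ℝ := fun j => ⟨μ (max j n), (hn _ (le_max_right _ _)).1⟩
  have hμ' : ∀ᶠ j in atTop, (μ' j : Measure ℝ) = μ j := by
    filter_upwards [eventually_ge_atTop n] with j hj
    change μ (max j n) = μ j
    rw [max_eq_left hj]
  -- Compactness gives a limit measure along an ultrafilter. The integrals converge along the whole
  -- sequence, so they must converge to the integral against that measure.
  let U : Ultrafilter ℕ := Ultrafilter.of atTop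
  have hU : (U : Filter ℕ) ≤ atTop := Ultrafilter.of_le atTop
  obtain ⟨ν, -, hν⟩ := (isCompact_closure_isProbOn M).ultrafilter_le_nhds' (U.map μ') (by
    rw [Ultrafilter.mem_map]
    exact Filter.Eventually.of_forall fun j => subset_closure (hn _ (le_max_right _ _)))
  refine ⟨ν, ν.2, fun f => ?_⟩
  obtain ⟨l, hl⟩ := exists_tendsto_integral hμ hS (f := fun t => f t) f.continuous.continuousOn
  have h1 : Tendsto (fun j => ∫ t, f t ∂(μ' j : Measure ℝ)) U (𝓝 (∫ t, f t ∂(ν : Measure ℝ))) :=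
    ProbabilityMeasure.tendsto_iff_forall_integral_tendsto.1 hν f.toBCF
  have h2 : Tendsto (fun j => ∫ t, f t ∂(μ' j : Measure ℝ)) U (𝓝 l) :=
    (hl.congr' (hμ'.mono fun j hj => by rw [hj])).mono_left hU
  rwa [tendsto_nhds_unique h1 h2]

theorem tendsto_inv_ofReal_sub_cocompact (z : ℂ) :
    Tendsto (fun t : ℝ => ((t : ℂ) - z)⁻¹) (cocompact ℝ) (𝓝 0) := by
  refine tendsto_inv₀_cobounded.comp ?_
  rw [← Metric.cobounded_eq_cocompact, ← tendsto_norm_atTop_iff_cobounded]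
  refine tendsto_atTop_mono (f := fun t : ℝ => ‖t‖ + -‖z‖) (fun t => ?_)
    (tendsto_atTop_add_const_right _ _ tendsto_norm_cobounded_atTop)
  have := norm_sub_norm_le (t : ℂ) z
  rw [Complex.norm_real] at this
  linarith

/-- Weak `*` convergence implies pointwise convergence of Stieltjes transforms. -/
theorem ConvWeakStar.tendsto_stieltjes (hμ : ∀ᶠ j in atTop, IsProbOn M (μ j)) {ν : Measure ℝ}
    [IsProbabilityMeasure ν] (h : ConvWeakStar μ ν) {z : ℂ} (hz : z ∈ upperHalf) :
    Tendsto (fun j => stieltjes (μ j) z) atTop (𝓝 (stieltjes ν z)) := by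
  have hc := continuous_inv_ofReal_sub hz
  have h0 := tendsto_inv_ofReal_sub_cocompact z
  -- Real and imaginary parts of the Cauchy kernel vanish at infinity, hence are admissible test
  -- functions.
  let re : C₀(ℝ, ℝ) := ⟨⟨fun t => (((t : ℂ) - z)⁻¹).re, Complex.continuous_re.comp hc⟩,
    (Complex.continuous_re.tendsto' 0 0 rfl).comp h0⟩
  let im : C₀(ℝ, ℝ) := ⟨⟨fun t => (((t : ℂ) - z)⁻¹).im, Complex.continuous_im.comp hc⟩,
    (Complex.continuous_im.tendsto' 0 0 rfl).comp h0⟩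
  have key : ∀ ρ : Measure ℝ, IsProbabilityMeasure ρ →
      stieltjes ρ z = ((∫ t, re t ∂ρ : ℝ) : ℂ) + ((∫ t, im t ∂ρ : ℝ) : ℂ) * Complex.I := by
    intro ρ _
    exact (integral_re_add_im (integrable_inv_ofReal_sub (μ := ρ) hz)).symm
  rw [key ν inferInstance]
  refine Tendsto.congr' (hμ.mono fun j hj => (key _ hj.1).symm) ?_
  exact ((Complex.continuous_ofReal.tendsto _).comp (h re)).add
    (((Complex.continuous_ofReal.tendsto _).comp (h im)).mul_const _)

end WeakConvergence

/-! ### Spectral measures and resolvents of bounded self-adjoint operators -/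

/-- The product of a continuous function with a cutoff equal to `1` on `[-L, L]`. -/
noncomputable def mulCutoff (f : C(ℝ, ℝ)) (L : ℝ) : C_c(ℝ, ℝ) where
  toFun t := f t * max 0 (min 1 (L + 1 - |t|))
  hasCompactSupport' := by
    refine HasCompactSupport.intro (isCompact_Icc (a := -(L + 1)) (b := L + 1)) fun t ht => ?_
    have : L + 1 < |t| := lt_of_not_ge fun h => ht (abs_le.1 h)
    rw [max_eq_left (min_le_of_right_le (by linarith)), mul_zero]

theorem mulCutoff_apply (f : C(ℝ, ℝ)) (L t : ℝ) :
    mulCutoff f L t = f t * max 0 (min 1 (L + 1 - |t|)) := rfl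

theorem mulCutoff_eq (f : C(ℝ, ℝ)) {L t : ℝ} (ht : |t| ≤ L) : mulCutoff f L t = f t := by
  rw [mulCutoff_apply, min_eq_left (by linarith), max_eq_right zero_le_one, mul_one]

theorem mulCutoff_nonneg {f : C(ℝ, ℝ)} (hf : ∀ t, 0 ≤ f t) (L t : ℝ) : 0 ≤ mulCutoff f L t :=
  mul_nonneg (hf t) (le_max_left _ _)

section SpectralMeasure

variable {H : Type*} [NormedAddCommGroup H] [InnerProductSpace ℂ H] [CompleteSpace H]
  {T : H →L[ℂ] H} {v : H}

theorem abs_le_norm_of_mem_spectrum {t : ℝ} (ht : t ∈ spectrum ℝ T) : |t| ≤ ‖T‖ := by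
  have h := spectrum.norm_le_norm_mul_of_mem ht
  have h1 : ‖(1 : H →L[ℂ] H)‖ ≤ 1 := ContinuousLinearMap.norm_id_le
  calc |t| ≤ ‖T‖ * ‖(1 : H →L[ℂ] H)‖ := h
    _ ≤ ‖T‖ * 1 := by gcongr
    _ = ‖T‖ := mul_one _

/-- A function vanishing on $[-\|T\|,\|T\|]$ vanishes on the spectrum, so its functional calculus is
zero. The extra 1 leaves room for a continuous ramp, and the complement is exhausted by compact sets
because the Riesz bound is applied to those. -/
theorem spectralMeasure_compl_Icc (T : H →L[ℂ] H) (v : H) :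
    spectralMeasure T v (Set.Icc (-(‖T‖ + 1)) (‖T‖ + 1))ᶜ = 0 := by
  let f : C(ℝ, ℝ) := ⟨fun t => max 0 (min 1 (|t| - ‖T‖)), by fun_prop⟩
  have hK : ∀ n : ℕ, spectralMeasure T v {t | ‖T‖ + 1 ≤ |t| ∧ |t| ≤ n} = 0 := by
    intro n
    have hcomp : IsCompact {t : ℝ | ‖T‖ + 1 ≤ |t| ∧ |t| ≤ n} :=
      (isCompact_Icc (a := -(n : ℝ)) (b := n)).of_isClosed_subset
        ((isClosed_le continuous_const continuous_abs).inter
          (isClosed_le continuous_abs continuous_const)) fun t ht => abs_le.1 ht.2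
    have h := RealRMK.rieszMeasure_le_of_eq_one (spectralFunctional T v) (f := mulCutoff f n)
      (mulCutoff_nonneg (fun t => le_max_left _ _) _) hcomp (fun t ht => by
        rw [mulCutoff_eq f ht.2]
        change max 0 (min 1 (|t| - ‖T‖)) = 1
        rw [min_eq_left (by linarith [ht.1]), max_eq_right zero_le_one])
    have h0 : spectralFunctional T v (mulCutoff f n) = 0 := by
      change (inner ℂ v ((cfc (fun t : ℝ => mulCutoff f n t) T) v)).re = 0
      have : cfc (fun t : ℝ => mulCutoff f n t) T = cfc (0 : ℝ → ℝ) T := by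
        refine cfc_congr fun t ht => ?_
        have := abs_le_norm_of_mem_spectrum ht
        change max 0 (min 1 (|t| - ‖T‖)) * _ = 0
        rw [max_eq_left (min_le_of_right_le (by linarith)), zero_mul]
      rw [this, cfc_zero]
      simp
    rw [h0, ENNReal.ofReal_zero] at h
    exact le_antisymm h zero_le
  refine measure_mono_null (t := ⋃ n : ℕ, {t | ‖T‖ + 1 ≤ |t| ∧ |t| ≤ n}) (fun t ht => ?_)
    (measure_iUnion_null hK)
  obtain ⟨n, hn⟩ := exists_nat_ge |t|
  have : ‖T‖ + 1 < |t| := lt_of_not_ge fun h => ht (abs_le.1 h)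
  exact Set.mem_iUnion.2 ⟨n, this.le, hn⟩

/-- Cutting `f` off outside the support changes neither the integral nor `cfc f T`, so the Riesz
formula extends beyond compactly supported functions. -/
theorem integral_spectralMeasure_of_continuous (T : H →L[ℂ] H) (v : H) {f : ℝ → ℝ}
    (hf : Continuous f) :
    ∫ t, f t ∂(spectralMeasure T v) = (inner ℂ v ((cfc f T) v)).re := by
  let g : C(ℝ, ℝ) := ⟨f, hf⟩
  have h1 : ∫ t, f t ∂(spectralMeasure T v)
      = ∫ t, mulCutoff g (‖T‖ + 1) t ∂(spectralMeasure T v) := by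
    have hae : ∀ᵐ t ∂(spectralMeasure T v), t ∈ Set.Icc (-(‖T‖ + 1)) (‖T‖ + 1) :=
      spectralMeasure_compl_Icc T v
    refine integral_congr_ae ?_
    filter_upwards [hae] with t ht
    exact (mulCutoff_eq g (abs_le.2 ht)).symm
  rw [h1, integral_spectralMeasure]
  have h2 : cfc (fun t : ℝ => mulCutoff g (‖T‖ + 1) t) T = cfc f T :=
    cfc_congr fun t ht => mulCutoff_eq g (by linarith [abs_le_norm_of_mem_spectrum ht])
  rw [h2]

theorem isProbOn_spectralMeasure (hT : IsSelfAdjoint T) (hv : ‖v‖ = 1) :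
    IsProbOn (‖T‖ + 1) (spectralMeasure T v) := by
  refine ⟨?_, spectralMeasure_compl_Icc T v⟩
  have h1 := integral_spectralMeasure_of_continuous T v (f := fun _ => (1 : ℝ)) continuous_const
  rw [cfc_const_one ℝ T] at h1
  have h2 : (inner ℂ v v).re = 1 := by
    have := inner_self_eq_norm_sq (𝕜 := ℂ) v
    rw [hv, one_pow] at this
    exact this
  have h3 : (spectralMeasure T v).real Set.univ = 1 := by
    rw [one_apply_eq_self, h2] at h1
    simpa using h1
  constructor
  have h4 := h3
  rw [Measure.real, ENNReal.toReal_eq_one_iff] at h4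
  exact h4

theorem inner_cfc_eq_integral (T : H →L[ℂ] H) (v : H) {f : ℝ → ℝ} (hf : Continuous f) :
    inner ℂ v ((cfc f T) v) = ((∫ t, f t ∂(spectralMeasure T v) : ℝ) : ℂ) := by
  rw [integral_spectralMeasure_of_continuous T v hf]
  have h : IsSelfAdjoint (cfc f T) := cfc_predicate f T
  have h2 := (ContinuousLinearMap.isSelfAdjoint_iff_isSymmetric.1 h)
  have h3 := h2.coe_re_inner_self_apply v
  simpa using h3.symm

/-- For a self-adjoint operator `T`, the resolvent `(T - z)⁻¹` as `f(T)` with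
`f(t) = (t - z)⁻¹`, split into real and imaginary parts. -/
theorem inverse_sub_smul_eq_cfc (hT : IsSelfAdjoint T) {z : ℂ} (hz : z ∈ upperHalf) :
    (T - z • (1 : H →L[ℂ] H)) * (cfc (fun t : ℝ => (((t : ℂ) - z)⁻¹).re) T
        + Complex.I • cfc (fun t : ℝ => (((t : ℂ) - z)⁻¹).im) T) = 1 ∧
    (cfc (fun t : ℝ => (((t : ℂ) - z)⁻¹).re) T
        + Complex.I • cfc (fun t : ℝ => (((t : ℂ) - z)⁻¹).im) T)
      * (T - z • (1 : H →L[ℂ] H)) = 1 := by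
  have hc := continuous_inv_ofReal_sub hz
  have hre : Continuous fun t : ℝ => (((t : ℂ) - z)⁻¹).re := Complex.continuous_re.comp hc
  have him : Continuous fun t : ℝ => (((t : ℂ) - z)⁻¹).im := Complex.continuous_im.comp hc
  set h1 := fun t : ℝ => (((t : ℂ) - z)⁻¹).re with h1def
  set h2 := fun t : ℝ => (((t : ℂ) - z)⁻¹).im with h2def
  have hid : cfc (fun t : ℝ => t) T = T := cfc_id' ℝ T
  -- Real and imaginary parts of $(t-z)(h_1+ih_2)=1$: the functional calculus is the real one, so
  -- the complex identity is carried by this pair.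
  have e : ∀ t : ℝ, t * h1 t = (z.re * h1 t + -z.im * h2 t) + 1 ∧
      t * h2 t = z.re * h2 t + z.im * h1 t := by
    intro t
    have h := mul_inv_cancel₀ (ofReal_sub_ne_zero hz t)
    have hr := congrArg Complex.re h
    have hi := congrArg Complex.im h
    rw [Complex.mul_re] at hr
    rw [Complex.mul_im] at hi
    simp only [Complex.sub_re, Complex.ofReal_re, Complex.sub_im, Complex.ofReal_im,
      Complex.one_re, Complex.one_im] at hr hi
    constructor <;> simp only [h1def, h2def] <;> linarith
  have hA : T * cfc h1 T = (z.re • cfc h1 T + (-z.im) • cfc h2 T) + 1 := by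
    calc T * cfc h1 T = cfc (fun t : ℝ => t) T * cfc h1 T := by rw [hid]
      _ = cfc (fun t : ℝ => t * h1 t) T :=
        (cfc_mul (fun t : ℝ => t) h1 T (by fun_prop) hre.continuousOn).symm
      _ = cfc (fun t : ℝ => (z.re * h1 t + -z.im * h2 t) + 1) T :=
        cfc_congr fun t _ => (e t).1
      _ = _ := by
        rw [cfc_add_const 1 (fun t : ℝ => z.re * h1 t + -z.im * h2 t) T
            (by fun_prop) hT, cfc_add T (fun t : ℝ => z.re * h1 t) (fun t : ℝ => -z.im * h2 t)
            (by fun_prop) (by fun_prop), cfc_const_mul _ h1 T hre.continuousOn,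
          cfc_const_mul _ h2 T him.continuousOn, map_one]
  have hB : T * cfc h2 T = z.re • cfc h2 T + z.im • cfc h1 T := by
    calc T * cfc h2 T = cfc (fun t : ℝ => t) T * cfc h2 T := by rw [hid]
      _ = cfc (fun t : ℝ => t * h2 t) T :=
        (cfc_mul (fun t : ℝ => t) h2 T (by fun_prop) him.continuousOn).symm
      _ = cfc (fun t : ℝ => z.re * h2 t + z.im * h1 t) T :=
        cfc_congr fun t _ => (e t).2
      _ = _ := by
        rw [cfc_add T (fun t : ℝ => z.re * h2 t) (fun t : ℝ => z.im * h1 t)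
            (by fun_prop) (by fun_prop), cfc_const_mul _ h1 T hre.continuousOn,
          cfc_const_mul _ h2 T him.continuousOn]
  have cA : cfc h1 T * T = T * cfc h1 T := by
    have := (cfc_commute_cfc h1 (fun t : ℝ => t) T).eq
    rwa [hid] at this
  have cB : cfc h2 T * T = T * cfc h2 T := by
    have := (cfc_commute_cfc h2 (fun t : ℝ => t) T).eq
    rwa [hid] at this
  have hzz : z = z.re + z.im * Complex.I := (Complex.re_add_im z).symm
  have main : (T * cfc h1 T + Complex.I • (T * cfc h2 T))
      - z • (cfc h1 T + Complex.I • cfc h2 T) = 1 := by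
    rw [hA, hB]
    generalize cfc h1 T = A
    generalize cfc h2 T = B
    simp only [← Complex.coe_smul]
    match_scalars <;> apply Complex.ext <;> simp
  constructor
  · rw [sub_mul, smul_mul_assoc, one_mul, mul_add, mul_smul_comm, main]
  · rw [mul_sub, mul_smul_comm, mul_one, add_mul, smul_mul_assoc, cA, cB, main]

theorem isUnit_sub_smul (hT : IsSelfAdjoint T) {z : ℂ} (hz : z ∈ upperHalf) :
    IsUnit (T - z • (1 : H →L[ℂ] H)) :=
  ⟨⟨_, _, (inverse_sub_smul_eq_cfc hT hz).1, (inverse_sub_smul_eq_cfc hT hz).2⟩, rfl⟩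

theorem inner_inverse_eq_stieltjes (hT : IsSelfAdjoint T) (hv : ‖v‖ = 1) {z : ℂ}
    (hz : z ∈ upperHalf) :
    inner ℂ v (Ring.inverse (T - z • (1 : H →L[ℂ] H)) v) = stieltjes (spectralMeasure T v) z := by
  have hc := continuous_inv_ofReal_sub hz
  obtain ⟨h1, h2⟩ := inverse_sub_smul_eq_cfc hT hz
  have h3 : Ring.inverse (T - z • (1 : H →L[ℂ] H)) = _ :=
    Ring.inverse_unit ⟨_, _, h1, h2⟩
  have hp := (isProbOn_spectralMeasure hT hv).1
  have hre : Continuous fun t : ℝ => (((t : ℂ) - z)⁻¹).re := Complex.continuous_re.comp hc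
  have him : Continuous fun t : ℝ => (((t : ℂ) - z)⁻¹).im := Complex.continuous_im.comp hc
  rw [h3]
  simp only [Units.inv_mk, add_apply, smul_apply, inner_add_right, inner_smul_right]
  rw [inner_cfc_eq_integral T v hre, inner_cfc_eq_integral T v him, mul_comm]
  exact integral_re_add_im (integrable_inv_ofReal_sub (μ := spectralMeasure T v) hz)

end SpectralMeasure

/-! ### Unit vectors and extension by zero -/

@[simp] theorem extendZero_zero (u : ℕ+ → ℂ) : extendZero u 0 = 0 := by simp [extendZero]

theorem extendZero_succ (u : ℕ+ → ℂ) (n : ℕ) : extendZero u (n + 1) = u n.succPNat := by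
  simp only [extendZero, Nat.succ_pos, dite_true]; rfl

theorem extendZero_coe (u : ℕ+ → ℂ) (n : ℕ+) : extendZero u n = u n := by
  simp only [extendZero, n.pos, dite_true]; rfl

/-- `δ_n` indexed by `n : ℕ`, with `δ_0 = 0`. -/
noncomputable def deltaNat (n : ℕ) : ℓ²(ℕ+, ℂ) := if h : 0 < n then delta (n.toPNat h) else 0

theorem deltaNat_zero : deltaNat 0 = 0 := by simp [deltaNat]

theorem deltaNat_succ (n : ℕ) : deltaNat (n + 1) = delta n.succPNat := by
  simp only [deltaNat, Nat.succ_pos, dite_true]; rfl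

theorem deltaNat_coe (n : ℕ+) : deltaNat n = delta n := by
  simp only [deltaNat, n.pos, dite_true]; rfl

theorem delta_apply (n m : ℕ+) : delta n m = if (n : ℕ) = m then 1 else 0 := by
  rw [delta, lp.single_apply, Pi.single_apply]
  simp only [PNat.coe_inj, eq_comm]

theorem deltaNat_apply (n : ℕ) (m : ℕ+) : deltaNat n m = if n = (m : ℕ) then 1 else 0 := by
  rcases Nat.eq_zero_or_pos n with rfl | hn
  · have := m.pos
    rw [deltaNat_zero, if_neg (by omega)]; rfl
  · have h : deltaNat n = delta (n.toPNat hn) := deltaNat_coe (n.toPNat hn)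
    rw [h, delta_apply]; rfl

theorem extendZero_deltaNat (n m : ℕ) :
    extendZero (deltaNat n) m = if n = m ∧ 0 < m then 1 else 0 := by
  rcases Nat.eq_zero_or_pos m with rfl | hm
  · simp
  · have h : extendZero (deltaNat n) m = deltaNat n (m.toPNat hm) := extendZero_coe _ (m.toPNat hm)
    rw [h, deltaNat_apply]
    simp only [hm, and_true]
    rfl

theorem norm_delta (n : ℕ+) : ‖delta n‖ = 1 := by
  rw [delta, lp.norm_single (by norm_num)]; simp

theorem inner_delta (n : ℕ+) (u : ℓ²(ℕ+, ℂ)) : inner ℂ (delta n) u = u n := by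
  rw [delta, lp.inner_single_left]; simp

theorem tendsto_extendZero (u : ℓ²(ℕ+, ℂ)) : Tendsto (extendZero u) atTop (𝓝 0) := by
  have h := (extendZero_comp_sq u (fun n : ℕ+ => (n : ℕ)) PNat.coe_injective).1
  generalize extendZero u = U at h ⊢
  have hs : Summable fun n : ℕ => ‖U (n + 1)‖ ^ 2 := by
    have h2 := h.comp_injective Nat.succPNat_injective
    simpa only [Function.comp_def, Nat.succPNat_coe] using h2
  have hs' : Summable fun n : ℕ => ‖U n‖ ^ 2 :=
    (summable_nat_add_iff (f := fun n : ℕ => ‖U n‖ ^ 2) 1).1 hs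
  have h1 : Tendsto (fun n => √(‖U n‖ ^ 2)) atTop (𝓝 √0) :=
    (Real.continuous_sqrt.tendsto 0).comp hs'.tendsto_atTop_zero
  rw [Real.sqrt_zero] at h1
  refine tendsto_zero_iff_norm_tendsto_zero.2 (h1.congr fun n => ?_)
  exact Real.sqrt_sq (norm_nonneg _)

/-! ### Self-adjointness of the Jacobi matrix, its solutions and Green function -/

namespace JacobiCoeff

variable (c : JacobiCoeff)

theorem J_apply (u : ℓ²(ℕ+, ℂ)) (n : ℕ+) : c.J u n = c.action u n := rfl

theorem exists_bound : ∃ K : ℝ, 1 ≤ K ∧ (∀ n, K⁻¹ ≤ c.a n ∧ c.a n ≤ K) ∧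
    ∀ n, 1 ≤ n → |c.b n| ≤ K := by
  obtain ⟨C, hC, hb⟩ := c.bounds
  refine ⟨C + 1, by linarith, fun n => ?_, fun n hn => by linarith [(hb n hn).2.2]⟩
  rcases Nat.eq_zero_or_pos n with rfl | hn
  · rw [c.a_zero]
    exact ⟨inv_le_one_of_one_le₀ (by linarith), by linarith⟩
  · exact ⟨(hb n hn).1, (hb n hn).2.1⟩

theorem a_pos (n : ℕ) : 0 < c.a n := by
  obtain ⟨K, hK, ha, -⟩ := c.exists_bound
  exact (inv_pos.2 (by linarith)).trans_le (ha n).1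

theorem a_ne_zero (n : ℕ) : (c.a n : ℂ) ≠ 0 := Complex.ofReal_ne_zero.2 (c.a_pos n).ne'

theorem action_succPNat (u : ℕ+ → ℂ) (n : ℕ) : c.action u n.succPNat
    = c.a (n + 1) * extendZero u (n + 2) + c.a n * extendZero u n
      + c.b (n + 1) * extendZero u (n + 1) := rfl

theorem J_deltaNat_succ (n : ℕ) : c.J (deltaNat (n + 1)) = (c.a (n + 1) : ℂ) • deltaNat (n + 2)
    + (c.a n : ℂ) • deltaNat n + (c.b (n + 1) : ℂ) • deltaNat (n + 1) := by
  refine lp.ext (funext fun m => ?_)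
  obtain ⟨k, rfl⟩ : ∃ k : ℕ, m = k.succPNat := ⟨m.natPred, by simp⟩
  rw [J_apply, action_succPNat]
  simp only [lp.coeFn_add, lp.coeFn_smul, Pi.add_apply, Pi.smul_apply, smul_eq_mul,
    extendZero_deltaNat, deltaNat_apply, Nat.succPNat_coe]
  by_cases h1 : n + 1 = k + 2
  · obtain rfl : n = k + 1 := by omega
    simp; omega
  by_cases h2 : n = k
  · subst h2; simp
  by_cases h3 : n + 2 = k + 1
  · obtain rfl : k = n + 1 := by omega
    have e : ¬ n = n + 1 + 1 := by omega
    simp [e]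
  have e1 : ¬ n + 2 = k + 1 := h3
  simp; grind

theorem J_delta_symm (m n : ℕ+) : c.J (delta m) n = c.J (delta n) m := by
  obtain ⟨k, rfl⟩ : ∃ k : ℕ, m = k.succPNat := ⟨m.natPred, by simp⟩
  obtain ⟨l, rfl⟩ : ∃ k : ℕ, n = k.succPNat := ⟨n.natPred, by simp⟩
  rw [← deltaNat_succ, ← deltaNat_succ, J_deltaNat_succ, J_deltaNat_succ]
  simp only [lp.coeFn_add, lp.coeFn_smul, Pi.add_apply, Pi.smul_apply, smul_eq_mul,
    deltaNat_apply, Nat.succPNat_coe]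
  grind

/-- The matrix entries are real and symmetric, so adjoint and operator agree on every `delta n`; the
norm convergent expansion of a vector extends this by continuity. -/
theorem isSelfAdjoint_J : IsSelfAdjoint c.J := by
  have hd : ∀ n, ContinuousLinearMap.adjoint c.J (delta n) = c.J (delta n) := by
    intro n
    refine lp.ext (funext fun m => ?_)
    rw [← inner_delta m, ContinuousLinearMap.adjoint_inner_right, ← inner_conj_symm, inner_delta,
      c.J_delta_symm]
    obtain ⟨k, rfl⟩ : ∃ k : ℕ, n = k.succPNat := ⟨n.natPred, by simp⟩
    rw [← deltaNat_succ, J_deltaNat_succ]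
    simp only [lp.coeFn_add, lp.coeFn_smul, Pi.add_apply, Pi.smul_apply, smul_eq_mul,
      deltaNat_apply, map_add, map_mul, Complex.conj_ofReal, apply_ite (starRingEnd ℂ), map_one,
      map_zero]
  refine ContinuousLinearMap.ext fun u => ?_
  have hu : HasSum (fun n => u n • delta n) u := by
    have := lp.hasSum_single (p := 2) (by norm_num) u
    convert this using 2 with n
    rw [delta, ← lp.single_smul]
    simp
  have h1 := hu.mapL (ContinuousLinearMap.adjoint c.J)
  have h2 := hu.mapL c.J
  simp only [map_smul, hd] at h1 h2
  exact h1.unique h2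

theorem isProbOn_spectralMeasure_delta (n : ℕ+) :
    IsProbOn (‖c.J‖ + 1) (spectralMeasure c.J (delta n)) :=
  isProbOn_spectralMeasure c.isSelfAdjoint_J (norm_delta n)

theorem green_eq_stieltjes {z : ℂ} (hz : z ∈ upperHalf) (n : ℕ+) :
    c.green n z = stieltjes (spectralMeasure c.J (delta n)) z :=
  inner_inverse_eq_stieltjes c.isSelfAdjoint_J (norm_delta n) hz

theorem im_green_pos {z : ℂ} (hz : z ∈ upperHalf) (n : ℕ+) : 0 < (c.green n z).im := by
  have := (c.isProbOn_spectralMeasure_delta n).1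
  rw [c.green_eq_stieltjes hz]
  exact im_stieltjes_pos hz

theorem norm_green_le {z : ℂ} (hz : z ∈ upperHalf) (n : ℕ+) : ‖c.green n z‖ ≤ (z.im)⁻¹ := by
  have := (c.isProbOn_spectralMeasure_delta n).1
  rw [c.green_eq_stieltjes hz]
  exact norm_stieltjes_le hz

theorem J_resolventJ {z : ℂ} (hz : z ∈ upperHalf) (u : ℓ²(ℕ+, ℂ)) : c.J (c.resolventJ z u) - z • c.resolventJ z u = u := by
  have h := Ring.mul_inverse_cancel _ (isUnit_sub_smul c.isSelfAdjoint_J hz)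
  exact congrArg (fun T : ℓ²(ℕ+, ℂ) →L[ℂ] ℓ²(ℕ+, ℂ) => T u) h

theorem resolventJ_J {z : ℂ} (hz : z ∈ upperHalf) (u : ℓ²(ℕ+, ℂ)) : c.resolventJ z (c.J u) - z • c.resolventJ z u = u := by
  have h := Ring.inverse_mul_cancel _ (isUnit_sub_smul c.isSelfAdjoint_J hz)
  have h2 := congrArg (fun T : ℓ²(ℕ+, ℂ) →L[ℂ] ℓ²(ℕ+, ℂ) => T u) h
  simp only [mul_apply_eq_comp, sub_apply, smul_apply, one_apply_eq_self, map_sub, map_smul] at h2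
  exact h2

theorem solution_succ_succ (z f₀ f₁ : ℂ) (n : ℕ) :
    c.a (n + 1) * c.solution z f₀ f₁ (n + 2)
      = (z - c.b (n + 1)) * c.solution z f₀ f₁ (n + 1) - c.a n * c.solution z f₀ f₁ n := by
  rw [solution, mul_div_cancel₀ _ (c.a_ne_zero (n + 1))]

theorem fMinus_zero (z : ℂ) : c.fMinus 0 z = 0 := rfl

theorem fMinus_one (z : ℂ) : c.fMinus 1 z = 1 := rfl

theorem fPlus_zero (z : ℂ) : c.fPlus 0 z = 1 := rfl

theorem fPlus_one (z : ℂ) : c.fPlus 1 z = -c.weylM z := rfl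

theorem fMinus_rec (z : ℂ) (n : ℕ) : c.a (n + 1) * c.fMinus (n + 2) z
    = (z - c.b (n + 1)) * c.fMinus (n + 1) z - c.a n * c.fMinus n z :=
  c.solution_succ_succ z 0 1 n

theorem fPlus_rec (z : ℂ) (n : ℕ) : c.a (n + 1) * c.fPlus (n + 2) z
    = (z - c.b (n + 1)) * c.fPlus (n + 1) z - c.a n * c.fPlus n z :=
  c.solution_succ_succ z _ _ n

/-- The Wronskian is constant in `n`; the value 1 comes from $a(0)=1$ and the initial data. -/
theorem wronskian_fPlus_fMinus (z : ℂ) (n : ℕ) :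
    c.a n * (c.fPlus n z * c.fMinus (n + 1) z - c.fPlus (n + 1) z * c.fMinus n z) = 1 := by
  induction n with
  | zero => simp [c.a_zero, fMinus_zero, fMinus_one, fPlus_zero]
  | succ n ih =>
    have h1 := c.fMinus_rec z n
    have h2 := c.fPlus_rec z n
    linear_combination ih + c.fPlus (n + 1) z * h1 - c.fMinus (n + 1) z * h2

theorem action_succ_of_resolvent {z : ℂ} (hz : z ∈ upperHalf) (u : ℓ²(ℕ+, ℂ)) (n : ℕ) :
    c.a (n + 1) * extendZero (c.resolventJ z u) (n + 2)
      + c.a n * extendZero (c.resolventJ z u) n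
      + (c.b (n + 1) - z) * extendZero (c.resolventJ z u) (n + 1) = u n.succPNat := by
  have h := congrArg (fun v : ℓ²(ℕ+, ℂ) => v n.succPNat) (c.J_resolventJ hz u)
  simp only [lp.coeFn_sub, lp.coeFn_smul, Pi.sub_apply, Pi.smul_apply, smul_eq_mul] at h
  rw [J_apply, action_succPNat, ← extendZero_succ (c.resolventJ z u)] at h
  linear_combination h

/-- The vector $(J-z)^{-1}\delta_1$ solves the recursion beyond site 1, and at site 1 its source
term plays the role of $a(0)f_+(0)=1$. Thus $f_+$ is the square summable solution. -/
theorem fPlus_succ_eq {z : ℂ} (hz : z ∈ upperHalf) (n : ℕ) :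
    c.fPlus (n + 1) z = -extendZero (c.resolventJ z (delta 1)) (n + 1) := by
  have h1 : c.fPlus 1 z = -extendZero (c.resolventJ z (delta 1)) 1 := by
    rw [fPlus_one, weylM, green, inner_delta, extendZero_succ]; rfl
  have key : ∀ n : ℕ, c.fPlus (n + 1) z = -extendZero (c.resolventJ z (delta 1)) (n + 1) ∧
      c.fPlus (n + 2) z = -extendZero (c.resolventJ z (delta 1)) (n + 2) := by
    intro n
    induction n with
    | zero =>
      refine ⟨h1, mul_left_cancel₀ (c.a_ne_zero 1) ?_⟩
      have h2 := c.action_succ_of_resolvent hz (delta 1) 0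
      have h3 := c.fPlus_rec z 0
      rw [delta_apply, extendZero_zero] at h2
      simp only [Nat.succPNat_coe, zero_add, PNat.one_coe, if_pos, Nat.succ_eq_add_one] at h2 h3 ⊢
      rw [h1, fPlus_zero, c.a_zero] at h3
      rw [h3]
      push_cast
      linear_combination h2
    | succ n ih =>
      refine ⟨ih.2, mul_left_cancel₀ (c.a_ne_zero (n + 2)) ?_⟩
      have h2 := c.action_succ_of_resolvent hz (delta 1) (n + 1)
      have h3 := c.fPlus_rec z (n + 1)
      rw [delta_apply, if_neg (by simp)] at h2
      rw [ih.1, ih.2] at h3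
      rw [h3]
      linear_combination h2
  exact (key n).1

theorem resolventJ_deltaNat_rec {z : ℂ} (hz : z ∈ upperHalf) (n : ℕ) :
    (c.a (n + 1) : ℂ) • c.resolventJ z (deltaNat (n + 2))
      + (c.a n : ℂ) • c.resolventJ z (deltaNat n)
      + (c.b (n + 1) - z : ℂ) • c.resolventJ z (deltaNat (n + 1)) = deltaNat (n + 1) := by
  have h := c.resolventJ_J hz (deltaNat (n + 1))
  rw [J_deltaNat_succ, map_add, map_add, map_smul, map_smul, map_smul] at h
  rw [sub_smul, ← add_sub_assoc]
  exact h

/-- Fix the row `m` and induct on the column: columns of the resolvent obey the recursion of $f_-$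
as long as the source stays left of `m`. The starting columns are `deltaNat 0 = 0` and
`fPlus_succ_eq`. -/
theorem resolventJ_deltaNat_apply {z : ℂ} (hz : z ∈ upperHalf) (n : ℕ) :
    ∀ m : ℕ+, n ≤ m → c.resolventJ z (deltaNat n) m = -c.fMinus n z * c.fPlus m z := by
  have key : ∀ n : ℕ,
      (∀ m : ℕ+, n ≤ m → c.resolventJ z (deltaNat n) m = -c.fMinus n z * c.fPlus m z) ∧
      (∀ m : ℕ+, n + 1 ≤ m →
        c.resolventJ z (deltaNat (n + 1)) m = -c.fMinus (n + 1) z * c.fPlus m z) := by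
    intro n
    induction n with
    | zero =>
      refine ⟨fun m _ => ?_, fun m _ => ?_⟩
      · rw [deltaNat_zero, map_zero, fMinus_zero, neg_zero, zero_mul]; rfl
      · obtain ⟨k, rfl⟩ : ∃ k : ℕ, m = k.succPNat := ⟨m.natPred, by simp⟩
        rw [Nat.succPNat_coe, c.fPlus_succ_eq hz, extendZero_succ, deltaNat_succ, fMinus_one]
        simp only [neg_mul, one_mul, neg_neg]; rfl
    | succ n ih =>
      refine ⟨ih.2, fun m hm => mul_left_cancel₀ (c.a_ne_zero (n + 1)) ?_⟩
      have h := congrArg (fun v : ℓ²(ℕ+, ℂ) => v m) (c.resolventJ_deltaNat_rec hz n)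
      simp only [lp.coeFn_add, lp.coeFn_smul, Pi.add_apply, Pi.smul_apply, smul_eq_mul,
        deltaNat_apply] at h
      rw [if_neg (by omega), ih.1 m (by omega), ih.2 m (by omega)] at h
      have h2 := c.fMinus_rec z n
      linear_combination h + c.fPlus m z * h2
  exact (key n).1

theorem green_eq {z : ℂ} (hz : z ∈ upperHalf) (n : ℕ+) :
    c.green n z = -c.fMinus n z * c.fPlus n z := by
  rw [green, inner_delta, ← deltaNat_coe]
  exact c.resolventJ_deltaNat_apply hz n n le_rfl

theorem green_ne_zero {z : ℂ} (hz : z ∈ upperHalf) (n : ℕ+) : c.green n z ≠ 0 := fun h => by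
  have := c.im_green_pos hz n
  rw [h] at this
  simp at this

theorem fMinus_ne_zero {z : ℂ} (hz : z ∈ upperHalf) (n : ℕ) : c.fMinus (n + 1) z ≠ 0 := fun h => by
  have h1 := c.green_eq hz n.succPNat
  rw [Nat.succPNat_coe, Nat.succ_eq_add_one, h, neg_zero, zero_mul] at h1
  exact c.green_ne_zero hz _ h1

theorem fPlus_ne_zero {z : ℂ} (hz : z ∈ upperHalf) (n : ℕ) : c.fPlus (n + 1) z ≠ 0 := fun h => by
  have h1 := c.green_eq hz n.succPNat
  rw [Nat.succPNat_coe, Nat.succ_eq_add_one, h, mul_zero] at h1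
  exact c.green_ne_zero hz _ h1

/-! ### Positivity of the imaginary parts of the m-functions -/

theorem a_mul_mPlus (n : ℕ) (z : ℂ) :
    c.a n * c.mPlus n z = -(c.fPlus (n + 1) z / c.fPlus n z) := by
  rw [mPlus, mul_neg, ← mul_div_assoc, mul_div_mul_left _ _ (c.a_ne_zero n)]

theorem a_mul_mMinus (n : ℕ) (z : ℂ) :
    c.a n * c.mMinus n z = c.fMinus (n + 1) z / c.fMinus n z := by
  rw [mMinus, ← mul_div_assoc, mul_div_mul_left _ _ (c.a_ne_zero n)]

/-- The flux `a(n) Im (conj f_+(n) f_+(n+1))` increases in `n`. -/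
theorem flux_succ (z : ℂ) (n : ℕ) :
    c.a (n + 1) * (starRingEnd ℂ (c.fPlus (n + 1) z) * c.fPlus (n + 2) z).im
      = c.a n * (starRingEnd ℂ (c.fPlus n z) * c.fPlus (n + 1) z).im
        + z.im * Complex.normSq (c.fPlus (n + 1) z) := by
  have h := congrArg (fun w => (starRingEnd ℂ (c.fPlus (n + 1) z) * w).im) (c.fPlus_rec z n)
  simp only [Complex.mul_im, Complex.sub_im, Complex.mul_re, Complex.conj_re, Complex.conj_im,
    Complex.sub_re, Complex.ofReal_re, Complex.ofReal_im, Complex.normSq_apply] at h ⊢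
  linear_combination h

theorem tendsto_flux {z : ℂ} (hz : z ∈ upperHalf) :
    Tendsto (fun n => c.a n * (starRingEnd ℂ (c.fPlus n z) * c.fPlus (n + 1) z).im) atTop
      (𝓝 0) := by
  obtain ⟨K, hK, ha, -⟩ := c.exists_bound
  have hf : Tendsto (fun n => ‖c.fPlus n z‖) atTop (𝓝 0) := by
    rw [← tendsto_add_atTop_iff_nat 1]
    have h := (tendsto_extendZero (c.resolventJ z (delta 1))).norm
    rw [norm_zero, ← tendsto_add_atTop_iff_nat 1] at h
    refine h.congr fun n => ?_
    rw [c.fPlus_succ_eq hz, norm_neg]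
  have h2 : Tendsto (fun n => K * (‖c.fPlus n z‖ * ‖c.fPlus (n + 1) z‖)) atTop (𝓝 0) := by
    simpa using (hf.mul ((tendsto_add_atTop_iff_nat 1).2 hf)).const_mul K
  refine squeeze_zero_norm (fun n => ?_) h2
  rw [norm_mul, Real.norm_eq_abs, abs_of_pos (c.a_pos n)]
  gcongr
  · exact (ha n).2
  · refine (Complex.abs_im_le_norm _).trans ?_
    rw [norm_mul, Complex.norm_conj]

/-- The flux is strictly increasing and tends to 0 because $f_+$ decays, so it is negative at every
site. -/
theorem flux_neg {z : ℂ} (hz : z ∈ upperHalf) (n : ℕ) :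
    (starRingEnd ℂ (c.fPlus n z) * c.fPlus (n + 1) z).im < 0 := by
  have hstep : ∀ n : ℕ, c.a n * (starRingEnd ℂ (c.fPlus n z) * c.fPlus (n + 1) z).im <
      c.a (n + 1) * (starRingEnd ℂ (c.fPlus (n + 1) z) * c.fPlus (n + 2) z).im := fun n => by
    rw [c.flux_succ]
    have : 0 < z.im * Complex.normSq (c.fPlus (n + 1) z) :=
      mul_pos hz (Complex.normSq_pos.2 (c.fPlus_ne_zero hz n))
    linarith
  have hmono := monotone_nat_of_le_succ fun n => (hstep n).le
  have h1 := (hstep n).trans_le (hmono.ge_of_tendsto (c.tendsto_flux hz) (n + 1))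
  by_contra h
  exact absurd h1 (not_lt.2 (mul_nonneg (c.a_pos n).le (not_lt.1 h)))

theorem im_a_mul_mPlus_pos {z : ℂ} (hz : z ∈ upperHalf) (n : ℕ) :
    0 < (c.a (n + 1) * c.mPlus (n + 1) z).im := by
  have h := c.flux_neg hz (n + 1)
  have h0 := c.fPlus_ne_zero hz n
  rw [a_mul_mPlus, Complex.neg_im, neg_pos]
  have e : c.fPlus (n + 2) z / c.fPlus (n + 1) z
      = (starRingEnd ℂ (c.fPlus (n + 1) z) * c.fPlus (n + 2) z)
        / (Complex.normSq (c.fPlus (n + 1) z) : ℂ) := by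
    have h1 : starRingEnd ℂ (c.fPlus (n + 1) z) ≠ 0 := (map_ne_zero _).2 h0
    rw [← Complex.mul_conj]
    field_simp
  rw [e, Complex.div_ofReal_im]
  exact div_neg_of_neg_of_pos h (Complex.normSq_pos.2 h0)

/-- The Riccati recursion for `a(n) m_-(n, z)`. -/
theorem ratioMinus_rec {z : ℂ} (hz : z ∈ upperHalf) (n : ℕ) :
    c.fMinus (n + 2) z / c.fMinus (n + 1) z = ((z - c.b (n + 1))
      - c.a n * (c.fMinus n z / c.fMinus (n + 1) z)) / c.a (n + 1) := by
  have h := c.fMinus_rec z n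
  have h1 := c.fMinus_ne_zero hz n
  have h2 := c.a_ne_zero (n + 1)
  field_simp
  linear_combination h

/-- If a ratio has positive imaginary part, its reciprocal has a nonpositive one, so the next
Riccati step gains at least $\operatorname{Im}z/a$. The induction starts from $f_-(0)/f_-(1)=0$. -/
theorem le_im_ratioMinus {z : ℂ} (hz : z ∈ upperHalf) (n : ℕ) :
    z.im / c.a (n + 1) ≤ (c.fMinus (n + 2) z / c.fMinus (n + 1) z).im := by
  have key : ∀ n, (c.fMinus n z / c.fMinus (n + 1) z).im ≤ 0 →
      z.im / c.a (n + 1) ≤ (c.fMinus (n + 2) z / c.fMinus (n + 1) z).im := by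
    intro n hn
    rw [c.ratioMinus_rec hz, Complex.div_ofReal_im]
    refine div_le_div_of_nonneg_right ?_ (c.a_pos _).le
    rw [Complex.sub_im, Complex.sub_im, Complex.ofReal_im, Complex.im_ofReal_mul]
    have := mul_nonpos_of_nonneg_of_nonpos (c.a_pos n).le hn
    linarith
  induction n with
  | zero => exact key 0 (by simp [fMinus_zero])
  | succ n ih =>
    refine key _ ?_
    have h0 : 0 < (c.fMinus (n + 2) z / c.fMinus (n + 1) z).im :=
      (div_pos hz (c.a_pos _)).trans_le ih
    rw [← inv_div, Complex.inv_im]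
    exact div_nonpos_of_nonpos_of_nonneg (by linarith) (Complex.normSq_nonneg _)

theorem im_a_mul_mMinus_pos {z : ℂ} (hz : z ∈ upperHalf) (n : ℕ) :
    0 < (c.a (n + 1) * c.mMinus (n + 1) z).im := by
  rw [a_mul_mMinus]
  exact (div_pos hz (c.a_pos _)).trans_le (c.le_im_ratioMinus hz n)

end JacobiCoeff

/-! ### Logarithms of the m-functions and the equivalence of (WP) and (WM) -/

theorem sum_Icc_one_eq_sum_range {E : Type*} [AddCommMonoid E] (f : ℕ → E) (N : ℕ) :
    ∑ n ∈ Finset.Icc 1 N, f n = ∑ i ∈ Finset.range N, f (i + 1) := by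
  induction N with
  | zero => simp
  | succ N ih => rw [Finset.sum_Icc_succ_top (by omega), ih, Finset.sum_range_succ]

theorem arg_mem_Ioo_of_im_pos {w : ℂ} (hw : 0 < w.im) : 0 < w.arg ∧ w.arg < Real.pi := by
  refine ⟨lt_of_le_of_ne (Complex.arg_nonneg_iff.2 hw.le) fun h => ?_,
    Complex.arg_lt_pi_iff.2 (Or.inr hw.ne')⟩
  have := (Complex.arg_eq_zero_iff.1 h.symm).2
  linarith

theorem mem_slitPlane_of_im_pos {w : ℂ} (hw : 0 < w.im) : w ∈ Complex.slitPlane :=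
  Or.inr hw.ne'

theorem im_div_norm_le_arg {w : ℂ} (hw : 0 < w.im) :
    w.im / ‖w‖ ≤ w.arg ∧ w.arg ≤ Real.pi - w.im / ‖w‖ := by
  obtain ⟨h0, h1⟩ := arg_mem_Ioo_of_im_pos hw
  rw [← Complex.sin_arg]
  refine ⟨Real.sin_le h0.le, ?_⟩
  have := Real.sin_le (sub_nonneg.2 h1.le)
  rw [Real.sin_pi_sub] at this
  linarith

theorem norm_log_le_of_im_pos {w : ℂ} {δ B : ℝ} (hδ : 0 < δ) (h1 : δ ≤ ‖w‖) (h2 : ‖w‖ ≤ B) :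
    ‖Complex.log w‖ ≤ |Real.log δ| + |Real.log B| + Real.pi := by
  have h := Complex.norm_le_abs_re_add_abs_im (Complex.log w)
  rw [Complex.log_re, Complex.log_im] at h
  have h3 := Complex.abs_arg_le_pi w
  have h4 : |Real.log ‖w‖| ≤ |Real.log δ| + |Real.log B| := by
    have hl := Real.log_le_log hδ h1
    have hu := Real.log_le_log (hδ.trans_le h1) h2
    rw [abs_le]
    constructor
    · linarith [neg_abs_le (Real.log δ), abs_nonneg (Real.log B)]
    · linarith [le_abs_self (Real.log B), abs_nonneg (Real.log δ)]
  linarith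

theorem ConvOnCompacts.differentiableOn {F : ℕ → ℂ → ℂ} {w : ℂ → ℂ} (hw : ConvOnCompacts F w)
    (hF : ∀ᶠ j in atTop, DifferentiableOn ℂ (F j) upperHalf) : DifferentiableOn ℂ w upperHalf :=
  hw.tendstoLocallyUniformlyOn.differentiableOn hF isOpen_upperHalf

namespace JacobiCoeff

variable (c : JacobiCoeff)

theorem wPlus_eq (N : ℕ) (z : ℂ) : c.wPlus N z
    = (1 / (N : ℂ)) * ∑ i ∈ Finset.range N, Complex.log (c.a (i + 1) * c.mPlus (i + 1) z) := by
  rw [wPlus, sum_Icc_one_eq_sum_range fun n => Complex.log (c.a n * c.mPlus n z)]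

theorem wMinus_eq (N : ℕ) (z : ℂ) : c.wMinus N z
    = (1 / (N : ℂ)) * ∑ i ∈ Finset.range N,
      Complex.log (c.fMinus (i + 2) z / c.fMinus (i + 1) z) := by
  rw [wMinus, sum_Icc_one_eq_sum_range fun n => Complex.log (c.a n * c.mMinus n z)]
  simp only [a_mul_mMinus]

/-- Exponentials agree because $G=-f_-f_+$. With $\pi i$ moved to the left, both sides have
imaginary part in $(-\pi,\pi)$, which excludes a multiple of $2\pi i$. Note that `n.succPNat` is the
site $n+1$. -/
theorem log_mPlus_add_log_mMinus {z : ℂ} (hz : z ∈ upperHalf) (n : ℕ) :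
    Complex.log (c.a (n + 1) * c.mPlus (n + 1) z)
      + Complex.log (c.fMinus (n + 2) z / c.fMinus (n + 1) z)
      = Real.pi * Complex.I + (Complex.log (c.green (n + 1).succPNat z)
        - Complex.log (c.green n.succPNat z)) := by
  have hp := c.im_a_mul_mPlus_pos hz n
  have hm := c.im_a_mul_mMinus_pos hz n
  rw [a_mul_mMinus] at hm
  have hg1 := c.im_green_pos hz (n + 1).succPNat
  have hg0 := c.im_green_pos hz n.succPNat
  have ne : ∀ {w : ℂ}, 0 < w.im → w ≠ 0 := fun h h0 => by rw [h0] at h; simp at h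
  have key := Complex.exp_inj_of_neg_pi_lt_of_le_pi
    (x := Complex.log (c.a (n + 1) * c.mPlus (n + 1) z)
      + Complex.log (c.fMinus (n + 2) z / c.fMinus (n + 1) z) - Real.pi * Complex.I)
    (y := Complex.log (c.green (n + 1).succPNat z) - Complex.log (c.green n.succPNat z))
  have ip := arg_mem_Ioo_of_im_pos hp
  have im := arg_mem_Ioo_of_im_pos hm
  have ig1 := arg_mem_Ioo_of_im_pos hg1
  have ig0 := arg_mem_Ioo_of_im_pos hg0
  have e := key (by simp [Complex.log_im]; linarith) (by simp [Complex.log_im]; linarith)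
    (by simp [Complex.log_im]; linarith) (by simp [Complex.log_im]; linarith) ?_
  · linear_combination e
  · rw [Complex.exp_sub, Complex.exp_add, Complex.exp_sub, Complex.exp_log (ne hp),
      Complex.exp_log (ne hm), Complex.exp_log (ne hg1), Complex.exp_log (ne hg0),
      Complex.exp_pi_mul_I, c.green_eq hz, c.green_eq hz, a_mul_mPlus]
    simp only [Nat.succPNat_coe, Nat.succ_eq_add_one]
    have h1 := c.fPlus_ne_zero hz n
    have h2 := c.fMinus_ne_zero hz n
    field_simp

theorem wPlus_add_wMinus {z : ℂ} (hz : z ∈ upperHalf) {N : ℕ} (hN : 1 ≤ N) :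
    c.wPlus N z + c.wMinus N z = Real.pi * Complex.I
      + (1 / (N : ℂ)) * (Complex.log (c.green N.succPNat z)
        - Complex.log (c.green (0 : ℕ).succPNat z)) := by
  have hN' : (N : ℂ) ≠ 0 := Nat.cast_ne_zero.2 (by omega)
  rw [wPlus_eq, wMinus_eq, ← mul_add, ← Finset.sum_add_distrib,
    Finset.sum_congr rfl fun i _ => c.log_mPlus_add_log_mMinus hz i, Finset.sum_add_distrib,
    Finset.sum_range_sub fun i => Complex.log (c.green i.succPNat z)]
  simp only [Finset.sum_const, Finset.card_range, nsmul_eq_mul]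
  field_simp

theorem le_im_green {z : ℂ} (hz : z ∈ upperHalf) (n : ℕ+) :
    z.im / (‖c.J‖ + 1 + ‖z‖) ^ 2 ≤ (c.green n z).im := by
  have h := c.isProbOn_spectralMeasure_delta n
  have := h.1
  rw [c.green_eq_stieltjes hz]
  exact le_im_stieltjes h.2 hz

theorem exists_norm_log_green_le {K : Set ℂ} (hK : IsCompact K) (hKU : K ⊆ upperHalf) :
    ∃ B : ℝ, ∀ z ∈ K, ∀ n, ‖Complex.log (c.green n z)‖ ≤ B := by
  obtain ⟨ε, hε, hKε⟩ := exists_pos_le_im_of_isCompact hK hKU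
  obtain ⟨R, hR⟩ := hK.isBounded.exists_norm_le
  refine ⟨_, fun z hz n => norm_log_le_of_im_pos (δ := ε / (‖c.J‖ + 1 + |R|) ^ 2) (B := ε⁻¹)
    (by positivity) ?_ ?_⟩
  · refine le_trans ?_ ((c.le_im_green (hKU hz) n).trans
      ((le_abs_self _).trans (Complex.abs_im_le_norm _)))
    have h1 := hKε z hz
    have h2 : ‖z‖ ≤ |R| := (hR z hz).trans (le_abs_self R)
    gcongr
    exact hε.le.trans h1
  · exact (c.norm_green_le (hKU hz) n).trans (inv_anti₀ hε (hKε z hz))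

/-- The boundary logarithms are bounded on compacts uniformly in the site and disappear after
division by $N_j$. Stated for abstract `F`, `G` so that it serves both directions. -/
theorem convOnCompacts_of_add_eq {F G : ℕ → ℂ → ℂ} {w : ℂ → ℂ} {N : ℕ → ℕ}
    (hN : Tendsto N atTop atTop) (hw : ConvOnCompacts F w)
    (h : ∀ j, 1 ≤ N j → ∀ z ∈ upperHalf, F j z + G j z = Real.pi * Complex.I
      + (1 / (N j : ℂ)) * (Complex.log (c.green (N j).succPNat z)
        - Complex.log (c.green (0 : ℕ).succPNat z))) :
    ConvOnCompacts G fun z => Real.pi * Complex.I - w z := by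
  intro K hK hKU
  obtain ⟨B, hB⟩ := c.exists_norm_log_green_le hK hKU
  rw [Metric.tendstoUniformlyOn_iff]
  intro η hη
  have hlim : Tendsto (fun j => (2 * B) / (N j : ℝ)) atTop (𝓝 0) :=
    tendsto_const_nhds.div_atTop (tendsto_natCast_atTop_atTop.comp hN)
  filter_upwards [Metric.tendstoUniformlyOn_iff.1 (hw K hK hKU) (η / 2) (by positivity),
    hN.eventually_ge_atTop 1, hlim.eventually_lt_const (half_pos hη)] with j h1 h2 h3 z hz
  have h4 := h1 z hz
  have h5 : Real.pi * Complex.I - w z - G j z = (F j z - w z)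
      - (1 / (N j : ℂ)) * (Complex.log (c.green (N j).succPNat z)
        - Complex.log (c.green (0 : ℕ).succPNat z)) := by
    linear_combination -h j h2 z (hKU hz)
  rw [dist_eq_norm] at h4 ⊢
  rw [h5]
  refine (norm_sub_le _ _).trans_lt ?_
  have h6 : ‖(1 / (N j : ℂ)) * (Complex.log (c.green (N j).succPNat z)
        - Complex.log (c.green (0 : ℕ).succPNat z))‖ ≤ 2 * B / (N j : ℝ) := by
    rw [norm_mul, norm_div, norm_one, Complex.norm_natCast, div_mul_eq_mul_div, one_mul]
    gcongr
    refine (norm_sub_le _ _).trans ?_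
    linarith [hB z hz (N j).succPNat, hB z hz (0 : ℕ).succPNat]
  rw [norm_sub_rev] at h4
  linarith

/-- `le_im_ratioMinus` bounds the reciprocal of the previous ratio, and one Riccati step then bounds
the next, uniformly in `n`. -/
theorem exists_norm_ratioMinus_le (ε R : ℝ) (hε : 0 < ε) :
    ∃ B : ℝ, 0 < B ∧ ∀ (z : ℂ) (n : ℕ), ε ≤ z.im → ‖z‖ ≤ R →
      ‖c.fMinus (n + 2) z / c.fMinus (n + 1) z‖ ≤ B := by
  obtain ⟨K, hK, ha, hb⟩ := c.exists_bound
  have hK0 : 0 < K := by linarith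
  refine ⟨(|R| + K + K * (ε⁻¹ * K)) * K, by positivity, fun z n hzε hzR => ?_⟩
  have hz : z ∈ upperHalf := hε.trans_le hzε
  have hinv : ∀ n, ‖c.fMinus n z / c.fMinus (n + 1) z‖ ≤ ε⁻¹ * K := by
    intro n
    cases n with
    | zero => rw [fMinus_zero, zero_div, norm_zero]; positivity
    | succ n =>
      rw [← inv_div, norm_inv]
      have h1 := (c.le_im_ratioMinus hz n).trans ((le_abs_self _).trans (Complex.abs_im_le_norm _))
      have h2 : ε / K ≤ z.im / c.a (n + 1) := by
        have := c.a_pos (n + 1)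
        have := (ha (n + 1)).2
        have : 0 ≤ z.im := hε.le.trans hzε
        gcongr
      have h3 := inv_anti₀ (by positivity) (h2.trans h1)
      rwa [inv_div ε, div_eq_inv_mul K] at h3
  rw [c.ratioMinus_rec hz, norm_div, Complex.norm_real, Real.norm_eq_abs, abs_of_pos (c.a_pos _),
    div_eq_mul_inv]
  have h1 : (c.a (n + 1))⁻¹ ≤ K := inv_le_of_inv_le₀ hK0 (ha (n + 1)).1
  have h2 : ‖(c.b (n + 1) : ℂ)‖ ≤ K := by
    rw [Complex.norm_real]; exact hb (n + 1) (by omega)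
  have h3 : ‖(c.a n : ℂ)‖ ≤ K := by
    rw [Complex.norm_real, Real.norm_eq_abs, abs_of_pos (c.a_pos n)]; exact (ha n).2
  have h4 := hinv n
  have h5 : ‖z‖ ≤ |R| := hzR.trans (le_abs_self R)
  have := inv_pos.2 (c.a_pos (n + 1))
  gcongr
  refine (norm_sub_le _ _).trans (add_le_add ((norm_sub_le _ _).trans (add_le_add h5 h2)) ?_)
  rw [norm_mul]
  gcongr

theorem differentiable_fMinus (n : ℕ) : Differentiable ℂ (c.fMinus n) := by
  have key : ∀ n, Differentiable ℂ (c.fMinus n) ∧ Differentiable ℂ (c.fMinus (n + 1)) := by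
    intro n
    induction n with
    | zero => exact ⟨differentiable_const (0 : ℂ), differentiable_const (1 : ℂ)⟩
    | succ n ih =>
      refine ⟨ih.2, ?_⟩
      have : c.fMinus (n + 2) = fun z => ((z - c.b (n + 1)) * c.fMinus (n + 1) z
          - c.a n * c.fMinus n z) / c.a (n + 1) := rfl
      have h1 := ih.1
      have h2 := ih.2
      change Differentiable ℂ (c.fMinus (n + 2))
      rw [this]
      fun_prop
  exact (key n).1

theorem differentiableAt_ratioMinus {z : ℂ} (hz : z ∈ upperHalf) (n : ℕ) :
    DifferentiableAt ℂ (fun z => c.fMinus (n + 2) z / c.fMinus (n + 1) z) z :=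
  (c.differentiable_fMinus _ z).fun_div (c.differentiable_fMinus _ z) (c.fMinus_ne_zero hz n)

theorem im_ratioMinus_pos {z : ℂ} (hz : z ∈ upperHalf) (n : ℕ) :
    0 < (c.fMinus (n + 2) z / c.fMinus (n + 1) z).im :=
  (div_pos hz (c.a_pos _)).trans_le (c.le_im_ratioMinus hz n)

theorem differentiableOn_wMinus (N : ℕ) : DifferentiableOn ℂ (c.wMinus N) upperHalf := by
  have : c.wMinus N = fun z => (1 / (N : ℂ)) * ∑ i ∈ Finset.range N,
      Complex.log (c.fMinus (i + 2) z / c.fMinus (i + 1) z) := funext (c.wMinus_eq N)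
  rw [this]
  refine DifferentiableOn.const_mul (DifferentiableOn.fun_sum fun i _ z hz => ?_) _
  exact ((c.differentiableAt_ratioMinus hz i).clog
    (mem_slitPlane_of_im_pos (c.im_ratioMinus_pos hz i))).differentiableWithinAt

/-- Since $\theta\ge\sin\theta=\operatorname{Im}w/|w|$ for $\theta=\arg w$, each argument keeps a
distance from $0$ and $\pi$ independent of the site, and averages inherit it. The lower bound makes
limits of $w_-$ Herglotz, the upper one does so for $\pi i-w_-$. -/
theorem exists_im_wMinus_mem {z : ℂ} (hz : z ∈ upperHalf) :
    ∃ δ > 0, ∀ N, 1 ≤ N → δ ≤ (c.wMinus N z).im ∧ (c.wMinus N z).im ≤ Real.pi - δ := by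
  have hz0 : 0 < z.im := hz
  obtain ⟨K, hK, ha, -⟩ := c.exists_bound
  have hK0 : 0 < K := by linarith
  obtain ⟨B, hB, hr⟩ := c.exists_norm_ratioMinus_le z.im ‖z‖ hz
  have key : ∀ i, z.im / K / B ≤ (c.fMinus (i + 2) z / c.fMinus (i + 1) z).arg ∧
      (c.fMinus (i + 2) z / c.fMinus (i + 1) z).arg ≤ Real.pi - z.im / K / B := by
    intro i
    obtain ⟨h1, h2⟩ := im_div_norm_le_arg (c.im_ratioMinus_pos hz i)
    have h3 : z.im / K / B ≤ (c.fMinus (i + 2) z / c.fMinus (i + 1) z).im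
        / ‖c.fMinus (i + 2) z / c.fMinus (i + 1) z‖ := by
      have h4 : 0 < ‖c.fMinus (i + 2) z / c.fMinus (i + 1) z‖ :=
        (c.im_ratioMinus_pos hz i).trans_le ((le_abs_self _).trans (Complex.abs_im_le_norm _))
      have h5 := hr z i le_rfl le_rfl
      have h6 : z.im / K ≤ (c.fMinus (i + 2) z / c.fMinus (i + 1) z).im := by
        refine le_trans ?_ (c.le_im_ratioMinus hz i)
        have := (ha (i + 1)).2
        have := c.a_pos (i + 1)
        gcongr
      have : 0 ≤ (c.fMinus (i + 2) z / c.fMinus (i + 1) z).im := (c.im_ratioMinus_pos hz i).le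
      gcongr
    exact ⟨h3.trans h1, h2.trans (by linarith)⟩
  refine ⟨z.im / K / B, by positivity, fun N hN => ?_⟩
  have hN0 : (0 : ℝ) < N := Nat.cast_pos.2 (by omega)
  have him : (c.wMinus N z).im = (1 / (N : ℝ)) * ∑ i ∈ Finset.range N,
      (c.fMinus (i + 2) z / c.fMinus (i + 1) z).arg := by
    have h1 : (1 / (N : ℂ)) = ((1 / (N : ℝ) : ℝ) : ℂ) := by push_cast; rfl
    rw [wMinus_eq, h1, Complex.im_ofReal_mul, Complex.im_sum]
    simp only [Complex.log_im]
  have h1 := Finset.card_nsmul_le_sum (Finset.range N)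
    (fun i => (c.fMinus (i + 2) z / c.fMinus (i + 1) z).arg) _ fun i _ => (key i).1
  have h2 := Finset.sum_le_card_nsmul (Finset.range N)
    (fun i => (c.fMinus (i + 2) z / c.fMinus (i + 1) z).arg) _ fun i _ => (key i).2
  rw [Finset.card_range, nsmul_eq_mul] at h1 h2
  rw [him, one_div, ← div_eq_inv_mul, le_div_iff₀ hN0, div_le_iff₀ hN0]
  constructor <;> linarith

theorem isHerglotz_of_wMinus {N : ℕ → ℕ} (hN : Tendsto N atTop atTop) {w : ℂ → ℂ}
    (hw : ConvOnCompacts (fun j => c.wMinus (N j)) w) :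
    IsHerglotz w ∧ ∀ z ∈ upperHalf, (w z).im < Real.pi := by
  have key : ∀ z ∈ upperHalf, 0 < (w z).im ∧ (w z).im < Real.pi := by
    intro z hz
    obtain ⟨δ, hδ, h⟩ := c.exists_im_wMinus_mem hz
    have hlim := (Complex.continuous_im.tendsto _).comp (hw.tendsto hz)
    have h1 := ge_of_tendsto hlim ((hN.eventually_ge_atTop 1).mono fun j hj => (h _ hj).1)
    have h2 := le_of_tendsto hlim ((hN.eventually_ge_atTop 1).mono fun j hj => (h _ hj).2)
    exact ⟨hδ.trans_le h1, by linarith⟩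
  exact ⟨⟨ConvOnCompacts.differentiableOn hw (Eventually.of_forall fun j => c.differentiableOn_wMinus _),
    fun z hz => (key z hz).1⟩, fun z hz => (key z hz).2⟩

theorem condWP_iff_condWM {N : ℕ → ℕ} (hN : Tendsto N atTop atTop) :
    c.CondWP N ↔ c.CondWM N := by
  constructor
  · rintro ⟨w, -, hw⟩
    have h := c.convOnCompacts_of_add_eq (G := fun j => c.wMinus (N j)) hN hw
      fun j hj z hz => c.wPlus_add_wMinus hz hj
    exact ⟨_, (c.isHerglotz_of_wMinus hN h).1, h⟩
  · rintro ⟨w, -, hw⟩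
    have h := c.convOnCompacts_of_add_eq (G := fun j => c.wPlus (N j)) hN hw
      fun j hj z hz => by rw [add_comm]; exact c.wPlus_add_wMinus hz hj
    obtain ⟨h1, h2⟩ := c.isHerglotz_of_wMinus hN hw
    refine ⟨_, ⟨(differentiableOn_const _).sub h1.1, fun z hz => ?_⟩, h⟩
    have := h2 z hz
    change 0 < (Real.pi * Complex.I - w z).im
    simpa using this

/-! ### Averaged Green function versus logarithmic derivative of $f_-$ -/

theorem deriv_fMinus_rec (z : ℂ) (n : ℕ) : c.a (n + 1) * deriv (c.fMinus (n + 2)) z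
    = (z - c.b (n + 1)) * deriv (c.fMinus (n + 1)) z + c.fMinus (n + 1) z
      - c.a n * deriv (c.fMinus n) z := by
  have h : (fun z => c.a (n + 1) * c.fMinus (n + 2) z)
      = fun z => (z - c.b (n + 1)) * c.fMinus (n + 1) z - c.a n * c.fMinus n z :=
    funext fun z => c.fMinus_rec z n
  have h1 := ((c.differentiable_fMinus (n + 2) z).hasDerivAt.const_mul (c.a (n + 1) : ℂ))
  have h2 := (((hasDerivAt_id z).sub_const (c.b (n + 1) : ℂ)).mul
    (c.differentiable_fMinus (n + 1) z).hasDerivAt).sub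
    ((c.differentiable_fMinus n z).hasDerivAt.const_mul (c.a n : ℂ))
  rw [h] at h1
  have h3 := h1.unique h2
  simp only [id] at h3
  linear_combination h3

/-- Christoffel-Darboux: differentiating the recursion in $z$ adds a source $f_-$, so the Wronskian
of $\partial_zf_-$ with $f_+$ grows by $f_-f_+$ at each site. It starts at 0 because $f_-(0)$ and
$f_-(1)$ do not depend on $z$. -/
theorem sum_fMinus_mul_fPlus (z : ℂ) (N : ℕ) :
    c.a N * (deriv (c.fMinus (N + 1)) z * c.fPlus N z - deriv (c.fMinus N) z * c.fPlus (N + 1) z)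
      = ∑ i ∈ Finset.range N, c.fMinus (i + 1) z * c.fPlus (i + 1) z := by
  induction N with
  | zero =>
    have h0 : c.fMinus 0 = fun _ => (0 : ℂ) := rfl
    have h1 : c.fMinus (0 + 1) = fun _ => (1 : ℂ) := rfl
    simp [h0, h1]
  | succ N ih =>
    rw [Finset.sum_range_succ, ← ih]
    linear_combination c.fPlus (N + 1) z * c.deriv_fMinus_rec z N
      - deriv (c.fMinus (N + 1)) z * c.fPlus_rec z N

/-- `g_N` differs from the logarithmic derivative of `-f_-(N+1)` by a boundary term. -/
theorem gN_add_logDeriv {z : ℂ} (hz : z ∈ upperHalf) (N : ℕ) :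
    ((N + 1 : ℕ) : ℂ) * c.gN (N + 1) z + logDeriv (c.fMinus (N + 2)) z
      = (1 + c.a (N + 1) * c.green N.succPNat z * (c.fMinus (N + 2) z / c.fMinus (N + 1) z))
        * logDeriv (fun z => c.fMinus (N + 2) z / c.fMinus (N + 1) z) z := by
  have hg : ((N + 1 : ℕ) : ℂ) * c.gN (N + 1) z
      = -∑ i ∈ Finset.range (N + 1), c.fMinus (i + 1) z * c.fPlus (i + 1) z := by
    have hN : ((N + 1 : ℕ) : ℂ) ≠ 0 := Nat.cast_ne_zero.2 N.succ_ne_zero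
    rw [gN, ← mul_assoc, mul_one_div_cancel hN, one_mul, ← Finset.sum_neg_distrib]
    refine Finset.sum_congr rfl fun i _ => ?_
    rw [c.green_eq hz, Nat.succPNat_coe, neg_mul]
  have hl : logDeriv (fun z => c.fMinus (N + 2) z / c.fMinus (N + 1) z) z
      = logDeriv (c.fMinus (N + 2)) z - logDeriv (c.fMinus (N + 1)) z :=
    logDeriv_div z (c.fMinus_ne_zero hz _) (c.fMinus_ne_zero hz _)
      (c.differentiable_fMinus _ z) (c.differentiable_fMinus _ z)
  rw [hg, ← c.sum_fMinus_mul_fPlus, hl, c.green_eq hz, Nat.succPNat_coe, logDeriv_apply,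
    logDeriv_apply]
  have h1 := c.fMinus_ne_zero hz N
  have h2 := c.fMinus_ne_zero hz (N + 1)
  have hW := c.wronskian_fPlus_fMinus z (N + 1)
  simp only [Nat.succ_eq_add_one, show N + 1 + 1 = N + 2 from rfl] at hW h2 ⊢
  field_simp
  -- The Wronskian at $N+1$ eliminates $f_+(N+2)$.
  linear_combination (-c.fMinus (N + 2) z * deriv (c.fMinus (N + 1)) z) * hW

/-- Cauchy's estimate on the disc of radius $\operatorname{Im}z/2$, combined with the lower bound
$\operatorname{Im}z/K$ on the ratio itself. -/
theorem exists_norm_logDeriv_ratioMinus_le {z : ℂ} (hz : z ∈ upperHalf) :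
    ∃ B : ℝ, ∀ n, ‖logDeriv (fun z => c.fMinus (n + 2) z / c.fMinus (n + 1) z) z‖ ≤ B := by
  have hz0 : 0 < z.im := hz
  have hr : 0 < z.im / 2 := half_pos hz0
  obtain ⟨K, hK, ha, -⟩ := c.exists_bound
  have hK0 : 0 < K := by linarith
  obtain ⟨B, hB, hbd⟩ := c.exists_norm_ratioMinus_le (z.im / 2) (‖z‖ + z.im / 2) hr
  have hball : ∀ w ∈ Metric.closedBall z (z.im / 2), z.im / 2 ≤ w.im ∧ ‖w‖ ≤ ‖z‖ + z.im / 2 := by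
    intro w hw
    have h1 : |(w - z).im| ≤ ‖w - z‖ := Complex.abs_im_le_norm _
    rw [Metric.mem_closedBall, dist_eq_norm] at hw
    have := (abs_le.1 (h1.trans hw)).1
    rw [Complex.sub_im] at this
    refine ⟨by linarith, ?_⟩
    have := norm_le_norm_add_norm_sub z w
    rw [norm_sub_rev] at this
    linarith
  refine ⟨B / (z.im / 2) / (z.im / K), fun n => ?_⟩
  rw [logDeriv_apply, norm_div]
  have h1 : ‖deriv (fun z => c.fMinus (n + 2) z / c.fMinus (n + 1) z) z‖ ≤ B / (z.im / 2) := by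
    refine Complex.norm_deriv_le_of_forall_mem_sphere_norm_le hr ?_ fun w hw => ?_
    · refine DifferentiableOn.diffContOnCl fun w hw => ?_
      rw [closure_ball _ hr.ne'] at hw
      exact (c.differentiableAt_ratioMinus (hr.trans_le (hball w hw).1) n).differentiableWithinAt
    · have := hball w (Metric.sphere_subset_closedBall hw)
      exact hbd w n this.1 this.2
  have h2 : z.im / K ≤ ‖c.fMinus (n + 2) z / c.fMinus (n + 1) z‖ := by
    refine le_trans ?_ ((c.le_im_ratioMinus hz n).trans
      ((le_abs_self _).trans (Complex.abs_im_le_norm _)))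
    have := (ha (n + 1)).2
    have := c.a_pos (n + 1)
    gcongr
  gcongr

theorem tendsto_gN_add_logDeriv {N : ℕ → ℕ} (hN : Tendsto N atTop atTop) {z : ℂ}
    (hz : z ∈ upperHalf) : Tendsto (fun j => c.gN (N j) z
      + (1 / (N j : ℂ)) * logDeriv (c.fMinus (N j + 1)) z) atTop (𝓝 0) := by
  obtain ⟨K, hK, ha, -⟩ := c.exists_bound
  have hK0 : 0 < K := by linarith
  have hz0 : 0 < z.im := hz
  obtain ⟨B, hB⟩ := c.exists_norm_logDeriv_ratioMinus_le hz
  obtain ⟨R, hR0, hR⟩ := c.exists_norm_ratioMinus_le z.im ‖z‖ hz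
  have hlim : Tendsto (fun j => ((1 + K * (z.im)⁻¹ * R) * B) / (N j : ℝ)) atTop (𝓝 0) :=
    tendsto_const_nhds.div_atTop (tendsto_natCast_atTop_atTop.comp hN)
  refine squeeze_zero_norm' ?_ hlim
  filter_upwards [hN.eventually_ge_atTop 1] with j hj
  obtain ⟨n, hn⟩ : ∃ n, N j = n + 1 := ⟨N j - 1, by omega⟩
  rw [hn]
  have hn0 : ((n + 1 : ℕ) : ℂ) ≠ 0 := Nat.cast_ne_zero.2 n.succ_ne_zero
  have e : c.gN (n + 1) z + (1 / ((n + 1 : ℕ) : ℂ)) * logDeriv (c.fMinus (n + 1 + 1)) z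
      = (((n + 1 : ℕ) : ℂ) * c.gN (n + 1) z + logDeriv (c.fMinus (n + 2)) z)
        / ((n + 1 : ℕ) : ℂ) := by
    field_simp
  rw [e, c.gN_add_logDeriv hz, norm_div, Complex.norm_natCast, norm_mul]
  have h1 : ‖(c.a (n + 1) : ℂ)‖ ≤ K := by
    rw [Complex.norm_real, Real.norm_eq_abs, abs_of_pos (c.a_pos _)]; exact (ha _).2
  have h2 := c.norm_green_le hz n.succPNat
  have h3 := hR z n le_rfl le_rfl
  gcongr
  · refine (norm_add_le _ _).trans ?_
    rw [norm_one, norm_mul, norm_mul]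
    gcongr
  · exact hB n

/-! ### Eigenvalues of the truncations and the measures they define -/

open Polynomial in
theorem charpoly_truncation_rec (N : ℕ) : (c.truncation (N + 2)).charpoly
    = (X - C (c.b (N + 2))) * (c.truncation (N + 1)).charpoly
      - C (c.a (N + 1) ^ 2) * (c.truncation N).charpoly := by
  have hsub : ∀ N, ((c.truncation (N + 1)).charmatrix.submatrix Fin.castSucc Fin.castSucc)
      = (c.truncation N).charmatrix := by
    intro N
    ext i k : 2
    simp only [Matrix.submatrix_apply, Matrix.charmatrix_apply, Matrix.diagonal_apply,
      Fin.castSucc_inj, truncation, Matrix.of_apply, Fin.val_castSucc]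
  set A := (c.truncation (N + 2)).charmatrix with hA
  have hentry : ∀ i k : Fin (N + 2), A i k = if (i : ℕ) = k then X - C (c.b ((i : ℕ) + 1))
      else if (k : ℕ) = (i : ℕ) + 1 then -C (c.a ((i : ℕ) + 1))
      else if (i : ℕ) = (k : ℕ) + 1 then -C (c.a ((k : ℕ) + 1)) else 0 := by
    intro i k
    rw [hA, Matrix.charmatrix_apply, Matrix.diagonal_apply, truncation, Matrix.of_apply]
    by_cases h : i = k
    · subst h; simp
    · have h' : ¬ (i : ℕ) = k := fun e => h (Fin.ext e)
      simp only [h, h', if_false, zero_sub]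
      split_ifs <;> simp
  -- The minor of the off-diagonal entry in the last row: its last column is zero except at the
  -- bottom, which leaves the matrix two sizes smaller.
  have hminor : (A.submatrix (Fin.last (N + 1)).succAbove
      (Fin.last N).castSucc.succAbove).det = -C (c.a (N + 1)) * (c.truncation N).charpoly := by
    rw [Matrix.det_succ_column _ (Fin.last N), Fin.sum_univ_castSucc, Finset.sum_eq_zero, zero_add]
    · have hcol : ∀ i : Fin N, (Fin.last N).castSucc.succAbove i.castSucc = i.castSucc.castSucc :=
        fun i => Fin.succAbove_of_castSucc_lt _ _ (Fin.castSucc_lt_castSucc_iff.2 i.castSucc_lt_last)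
      have hlast : (Fin.last N).castSucc.succAbove (Fin.last N) = Fin.last (N + 1) := by
        rw [Fin.succAbove_castSucc_self, Fin.succ_last]
      have hm : ((A.submatrix (Fin.last (N + 1)).succAbove
          (Fin.last N).castSucc.succAbove).submatrix (Fin.last N).succAbove
          (Fin.last N).succAbove) = (c.truncation N).charmatrix := by
        rw [← hsub N, ← hsub (N + 1)]
        ext i k : 2
        simp only [Matrix.submatrix_apply, Fin.succAbove_last, hcol]
        rfl
      rw [hm, Matrix.submatrix_apply, hlast, Fin.succAbove_last, hentry, ← Matrix.charpoly]
      simp [← two_mul]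
    · intro i _
      have hlast : (Fin.last N).castSucc.succAbove (Fin.last N) = Fin.last (N + 1) := by
        rw [Fin.succAbove_castSucc_self, Fin.succ_last]
      rw [Matrix.submatrix_apply, hlast, Fin.succAbove_last, hentry]
      have := i.isLt
      simp only [Fin.val_castSucc, Fin.val_last]
      rw [if_neg (by omega), if_neg (by omega), if_neg (by omega), mul_zero, zero_mul]
  rw [Matrix.charpoly, ← hA, Matrix.det_succ_row A (Fin.last (N + 1)), Fin.sum_univ_castSucc,
    Fin.sum_univ_castSucc, Finset.sum_eq_zero, zero_add, hminor]
  · have hm : A.submatrix (Fin.last (N + 1)).succAbove (Fin.last (N + 1)).succAbove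
        = (c.truncation (N + 1)).charmatrix := by
      rw [← hsub (N + 1)]
      simp only [Fin.succAbove_last]
      rfl
    rw [hm, hentry, hentry, ← Matrix.charpoly]
    simp only [Fin.val_castSucc, Fin.val_last]
    rw [if_neg (by omega), if_neg (by omega), if_pos trivial, if_pos trivial, Even.neg_one_pow ⟨N + 1, rfl⟩,
      Odd.neg_one_pow ⟨N, by ring⟩, map_pow]
    ring
  · intro i _
    rw [hentry]
    have := i.isLt
    simp only [Fin.val_castSucc, Fin.val_last]
    rw [if_neg (by omega), if_neg (by omega), if_neg (by omega), mul_zero, zero_mul]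

open Polynomial in
/-- The characteristic polynomial of the truncation is a multiple of `f_-(N+1, ·)`. -/
theorem aeval_charpoly_truncation (z : ℂ) (N : ℕ) : aeval z (c.truncation N).charpoly
    = (∏ n ∈ Finset.range N, (c.a (n + 1) : ℂ)) * c.fMinus (N + 1) z := by
  have key : ∀ N, aeval z (c.truncation N).charpoly
      = (∏ n ∈ Finset.range N, (c.a (n + 1) : ℂ)) * c.fMinus (N + 1) z ∧
      aeval z (c.truncation (N + 1)).charpoly
      = (∏ n ∈ Finset.range (N + 1), (c.a (n + 1) : ℂ)) * c.fMinus (N + 2) z := by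
    intro N
    induction N with
    | zero =>
      refine ⟨by simp [Matrix.charpoly, fMinus_one], ?_⟩
      have h : (c.truncation 1).charpoly = X - C (c.b 1) := by
        rw [Matrix.charpoly, Matrix.det_fin_one, Matrix.charmatrix_apply]
        simp [truncation]
      have h2 := c.fMinus_rec z 0
      rw [fMinus_zero, fMinus_one] at h2
      rw [zero_add, h]
      simp only [zero_add, map_sub, aeval_X, aeval_C, Finset.prod_range_one,
        Complex.coe_algebraMap] at h2 ⊢
      linear_combination -h2
    | succ N ih =>
      refine ⟨ih.2, ?_⟩
      have h2 := c.fMinus_rec z (N + 1)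
      rw [charpoly_truncation_rec, map_sub, map_mul, map_mul, ih.1, ih.2, Finset.prod_range_succ _ (N + 1),
        Finset.prod_range_succ _ N]
      simp only [map_sub, aeval_X, aeval_C, Complex.coe_algebraMap, Complex.ofReal_pow]
      linear_combination (-(∏ n ∈ Finset.range N, (c.a (n + 1) : ℂ)) * c.a (N + 1)) * h2
  exact (key N).1

/-- The eigenvalues of the truncation. -/
noncomputable def eig (N : ℕ) (i : Fin N) : ℝ := (c.truncation_isHermitian N).eigenvalues i

theorem prod_sub_eig (z : ℂ) (N : ℕ) : ∏ i, (z - c.eig N i)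
    = (∏ n ∈ Finset.range N, (c.a (n + 1) : ℂ)) * c.fMinus (N + 1) z := by
  rw [← aeval_charpoly_truncation, (c.truncation_isHermitian N).charpoly_eq, map_prod]
  refine Finset.prod_congr rfl fun i _ => ?_
  simp [eig]

/-- For $|z|\ge3K$ one has $|z-b|\ge2K$, and subtracting $a(n)|f_-(n)|\le K|f_-(n+1)|$ still leaves
$K|f_-(n+1)|$. So $|f_-|$ does not decrease and cannot vanish at an eigenvalue that large. -/
theorem exists_abs_eig_le : ∃ M : ℝ, 0 ≤ M ∧ ∀ N i, |c.eig N i| ≤ M := by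
  obtain ⟨K, hK, ha, hb⟩ := c.exists_bound
  have hK0 : 0 < K := by linarith
  have hgrow : ∀ z : ℂ, 3 * K ≤ ‖z‖ → ∀ n, ‖c.fMinus n z‖ ≤ ‖c.fMinus (n + 1) z‖ ∧
      0 < ‖c.fMinus (n + 1) z‖ := by
    intro z hz n
    induction n with
    | zero => simp [fMinus_zero, fMinus_one]
    | succ n ih =>
      have hle : ‖c.fMinus (n + 1) z‖ ≤ ‖c.fMinus (n + 2) z‖ := by
        have h1 : ‖(c.b (n + 1) : ℂ)‖ ≤ K := by
          rw [Complex.norm_real]; exact hb (n + 1) (by omega)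
        have hn : ∀ m, ‖(c.a m : ℂ)‖ = c.a m := fun m => by
          rw [Complex.norm_real, Real.norm_eq_abs, abs_of_pos (c.a_pos m)]
        have h2 := congrArg norm (c.fMinus_rec z n)
        rw [norm_mul, hn] at h2
        have h3 := norm_sub_norm_le ((z - c.b (n + 1)) * c.fMinus (n + 1) z)
          (c.a n * c.fMinus n z)
        rw [norm_mul, norm_mul, hn] at h3
        have h4 := norm_sub_norm_le z (c.b (n + 1) : ℂ)
        have h5 : (2 * K) * ‖c.fMinus (n + 1) z‖
            ≤ ‖z - c.b (n + 1)‖ * ‖c.fMinus (n + 1) z‖ := by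
          gcongr; linarith
        have h6 : c.a n * ‖c.fMinus n z‖ ≤ K * ‖c.fMinus (n + 1) z‖ :=
          mul_le_mul (ha n).2 ih.1 (norm_nonneg _) hK0.le
        have h7 : c.a (n + 1) * ‖c.fMinus (n + 2) z‖ ≤ K * ‖c.fMinus (n + 2) z‖ := by
          gcongr; exact (ha _).2
        have h8 : K * ‖c.fMinus (n + 1) z‖ ≤ K * ‖c.fMinus (n + 2) z‖ := by linarith
        exact le_of_mul_le_mul_left h8 hK0
      exact ⟨hle, ih.2.trans_le hle⟩
  refine ⟨3 * K, by positivity, fun N i => ?_⟩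
  by_contra! h
  have h1 := c.prod_sub_eig (c.eig N i) N
  rw [Finset.prod_eq_zero (Finset.mem_univ i) (sub_self _)] at h1
  have h2 := (hgrow (c.eig N i) (by rw [Complex.norm_real]; exact h.le) N).2
  rcases mul_eq_zero.1 h1.symm with h3 | h3
  · obtain ⟨n, -, hn⟩ := Finset.prod_eq_zero_iff.1 h3
    exact c.a_ne_zero _ hn
  · rw [h3, norm_zero] at h2
    exact lt_irrefl _ h2

theorem integral_kN {E : Type*} [NormedAddCommGroup E] [NormedSpace ℝ E] [CompleteSpace E]
    (N : ℕ) (f : ℝ → E) : ∫ t, f t ∂(c.kN N) = (N : ℝ)⁻¹ • ∑ i, f (c.eig N i) := by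
  rw [kN, integral_smul_measure, integral_finsetSum_measure fun i _ => integrable_dirac (by simp)]
  simp [eig]

/-- The condition on `N` matters: `kN 0` is the zero measure, hence the eventual statements later.
-/
theorem isProbOn_kN {M : ℝ} (hM : ∀ N i, |c.eig N i| ≤ M) {N : ℕ} (hN : 1 ≤ N) :
    IsProbOn M (c.kN N) := by
  have hN0 : (N : ℝ≥0∞) ≠ 0 := Nat.cast_ne_zero.2 (by omega)
  constructor
  · constructor
    simp [kN, ENNReal.inv_mul_cancel hN0]
  · have : ∀ i, Measure.dirac ((c.truncation_isHermitian N).eigenvalues i)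
        (Set.Icc (-M) M)ᶜ = 0 := by
      intro i
      rw [Measure.dirac_apply' _ measurableSet_Icc.compl]
      simpa [eig] using abs_le.1 (hM N i)
    simp [kN, this]

theorem isProbOn_nuN {N : ℕ} (hN : 1 ≤ N) : IsProbOn (‖c.J‖ + 1) (c.nuN N) := by
  have hN0 : (N : ℝ≥0∞) ≠ 0 := Nat.cast_ne_zero.2 (by omega)
  have h1 : ∀ i : ℕ, spectralMeasure c.J (delta i.succPNat) Set.univ = 1 := fun i =>
    (c.isProbOn_spectralMeasure_delta _).1.measure_univ
  have h2 := fun i : ℕ => (c.isProbOn_spectralMeasure_delta i.succPNat).2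
  constructor
  · constructor
    simp [nuN, h1, ENNReal.inv_mul_cancel hN0]
  · simp only [nuN, Measure.smul_apply, Measure.finsetSum_apply, h2, Finset.sum_const_zero,
      smul_zero]

theorem stieltjes_nuN {z : ℂ} (hz : z ∈ upperHalf) (N : ℕ) : stieltjes (c.nuN N) z = c.gN N z := by
  have h1 := fun i : ℕ => (c.isProbOn_spectralMeasure_delta i.succPNat).1
  rw [stieltjes, nuN, integral_smul_measure,
    integral_finsetSum_measure fun i _ => integrable_inv_ofReal_sub hz, gN]
  simp only [c.green_eq_stieltjes hz, stieltjes]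
  simp

/-- Logarithmic derivative of the characteristic polynomial; the product of the $a(n)$ drops out. -/
theorem stieltjes_kN {z : ℂ} (hz : z ∈ upperHalf) (N : ℕ) :
    stieltjes (c.kN N) z = -((1 / (N : ℂ)) * logDeriv (c.fMinus (N + 1)) z) := by
  have hP : (∏ n ∈ Finset.range N, (c.a (n + 1) : ℂ)) ≠ 0 :=
    Finset.prod_ne_zero_iff.2 fun n _ => c.a_ne_zero _
  have h1 : logDeriv (fun w : ℂ => ∏ i, (w - c.eig N i)) z = logDeriv (c.fMinus (N + 1)) z := by
    rw [funext fun w => c.prod_sub_eig w N, logDeriv_const_mul _ _ hP]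
  have h2 : ∀ i, z - c.eig N i ≠ 0 := fun i h => ofReal_sub_ne_zero hz (c.eig N i) (by
    rw [← neg_sub, h, neg_zero])
  rw [← h1, logDeriv_prod (fun i _ => h2 i) fun i _ => by fun_prop, stieltjes, integral_kN,
    Complex.real_smul, ← mul_neg, ← Finset.sum_neg_distrib]
  push_cast
  rw [one_div]
  congr 1
  refine Finset.sum_congr rfl fun i _ => ?_
  have hd : deriv (fun w : ℂ => w - c.eig N i) z = 1 := by simp
  rw [logDeriv_apply, hd, one_div, ← inv_neg, neg_sub]

end JacobiCoeff

/-! ### The Thouless formula -/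

theorem sub_ofReal_im (z : ℂ) (t : ℝ) : (z - t).im = z.im := by simp

theorem I_mul_ofReal_mem {y : ℝ} (hy : 0 < y) : Complex.I * y ∈ upperHalf := by
  change 0 < (Complex.I * y).im
  simpa using hy

theorem tendsto_ofReal_inv_atTop : Tendsto (fun y : ℝ => ((y⁻¹ : ℝ) : ℂ)) atTop (𝓝 0) :=
  (Complex.continuous_ofReal.tendsto' 0 0 Complex.ofReal_zero).comp tendsto_inv_atTop_zero

/-- The argument ignores the positive factor $1/y$ and is continuous at points of the positive
imaginary axis. -/
theorem tendsto_arg_of_div {f : ℝ → ℂ} {a : ℝ} (ha : 0 < a)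
    (h : Tendsto (fun y : ℝ => ((y⁻¹ : ℝ) : ℂ) * f y) atTop (𝓝 (a * Complex.I))) :
    Tendsto (fun y => (f y).arg) atTop (𝓝 (Real.pi / 2)) := by
  have h1 : (a * Complex.I).arg = Real.pi / 2 := by
    rw [Complex.arg_real_mul _ ha, Complex.arg_I]
  have h2 : a * Complex.I ∈ Complex.slitPlane := mem_slitPlane_of_im_pos (by simpa using ha)
  have h3 := ((Complex.continuousAt_arg h2).tendsto.comp h)
  rw [h1] at h3
  refine h3.congr' ?_
  filter_upwards [eventually_gt_atTop 0] with y hy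
  exact Complex.arg_real_mul _ (inv_pos.2 hy)

namespace JacobiCoeff

variable (c : JacobiCoeff)

theorem tendsto_fMinus_div_fMinus_succ (n : ℕ) :
    Tendsto (fun y : ℝ => c.fMinus n (Complex.I * y) / c.fMinus (n + 1) (Complex.I * y)) atTop
      (𝓝 0) := by
  cases n with
  | zero => simp [fMinus_zero]
  | succ n =>
    have h : Tendsto (fun y : ℝ => y / c.a (n + 1)) atTop atTop :=
      tendsto_id.atTop_div_const (c.a_pos _)
    refine squeeze_zero_norm' ?_ h.inv_tendsto_atTop
    filter_upwards [eventually_gt_atTop 0] with y hy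
    have h1 := (c.le_im_ratioMinus (I_mul_ofReal_mem hy) n).trans
      ((le_abs_self _).trans (Complex.abs_im_le_norm _))
    have h2 : (Complex.I * y).im = y := by simp
    rw [h2] at h1
    rw [← inv_div, norm_inv]
    exact inv_anti₀ (div_pos hy (c.a_pos _)) h1

theorem tendsto_arg_ratioMinus (n : ℕ) :
    Tendsto (fun y : ℝ => (c.fMinus (n + 2) (Complex.I * y)
      / c.fMinus (n + 1) (Complex.I * y)).arg) atTop (𝓝 (Real.pi / 2)) := by
  refine tendsto_arg_of_div (a := (c.a (n + 1))⁻¹) (inv_pos.2 (c.a_pos _)) ?_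
  have h : Tendsto (fun y : ℝ => ((Complex.I - ((y⁻¹ : ℝ) : ℂ) * c.b (n + 1))
      - ((y⁻¹ : ℝ) : ℂ) * (c.a n * (c.fMinus n (Complex.I * y)
        / c.fMinus (n + 1) (Complex.I * y)))) / c.a (n + 1)) atTop
      (𝓝 (((Complex.I - 0 * c.b (n + 1)) - 0 * (c.a n * 0)) / c.a (n + 1))) :=
    ((tendsto_const_nhds.sub (tendsto_ofReal_inv_atTop.mul_const _)).sub
      (tendsto_ofReal_inv_atTop.mul
      ((c.tendsto_fMinus_div_fMinus_succ n).const_mul _))).div_const _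
  have e : ((Complex.I - 0 * c.b (n + 1)) - 0 * (c.a n * 0)) / c.a (n + 1)
      = (((c.a (n + 1))⁻¹ : ℝ) : ℂ) * Complex.I := by
    push_cast; rw [zero_mul, zero_mul, sub_zero, sub_zero]; ring
  rw [e] at h
  refine h.congr' ?_
  filter_upwards [eventually_gt_atTop 0] with y hy
  rw [c.ratioMinus_rec (I_mul_ofReal_mem hy)]
  have : (y : ℂ) ≠ 0 := Complex.ofReal_ne_zero.2 hy.ne'
  push_cast
  field_simp

theorem prod_ratioMinus {z : ℂ} (hz : z ∈ upperHalf) (N : ℕ) :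
    ∏ n ∈ Finset.range N, c.fMinus (n + 2) z / c.fMinus (n + 1) z = c.fMinus (N + 1) z := by
  induction N with
  | zero => simp [fMinus_one]
  | succ N ih => rw [Finset.prod_range_succ, ih, mul_div_cancel₀ _ (c.fMinus_ne_zero hz N)]

/-- The mean of `log a(n)`. -/
noncomputable def meanLogA (N : ℕ) : ℝ := (N : ℝ)⁻¹ * ∑ n ∈ Finset.range N, Real.log (c.a (n + 1))

/-- Both sides are logarithms of $f_-(N+1,z)$, so their difference is a constant in $2\pi i\mathbb
Z$. Along $z=iy$, $y\to\infty$, each of the $N$ arguments on either side tends to $\pi/2$, so the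
constant is 0. -/
theorem sum_log_ratioMinus {z : ℂ} (hz : z ∈ upperHalf) (N : ℕ) :
    ∑ n ∈ Finset.range N, Complex.log (c.fMinus (n + 2) z / c.fMinus (n + 1) z)
      = ∑ i, Complex.log (z - c.eig N i) - ∑ n ∈ Finset.range N, (Real.log (c.a (n + 1)) : ℂ) := by
  let D : ℂ → ℂ := fun z =>
    ∑ n ∈ Finset.range N, Complex.log (c.fMinus (n + 2) z / c.fMinus (n + 1) z)
      - (∑ i, Complex.log (z - c.eig N i) - ∑ n ∈ Finset.range N, (Real.log (c.a (n + 1)) : ℂ))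
  have him : ∀ w ∈ upperHalf, ∀ i, 0 < (w - c.eig N i).im := fun w hw i => by
    rw [sub_ofReal_im]; exact hw
  have ne : ∀ {w : ℂ}, 0 < w.im → w ≠ 0 := fun h h0 => by rw [h0] at h; simp at h
  have hexp : ∀ w ∈ upperHalf, Complex.exp (D w) = 1 := by
    intro w hw
    have e1 : ∏ n ∈ Finset.range N, Complex.exp (Complex.log
        (c.fMinus (n + 2) w / c.fMinus (n + 1) w)) = c.fMinus (N + 1) w := by
      rw [Finset.prod_congr rfl fun n _ => Complex.exp_log (ne (c.im_ratioMinus_pos hw n)),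
        c.prod_ratioMinus hw]
    have e2 : ∏ i, Complex.exp (Complex.log (w - c.eig N i)) = ∏ i, (w - c.eig N i) :=
      Finset.prod_congr rfl fun i _ => Complex.exp_log (ne (him w hw i))
    have e3 : ∏ n ∈ Finset.range N, Complex.exp (Real.log (c.a (n + 1)) : ℂ)
        = ∏ n ∈ Finset.range N, (c.a (n + 1) : ℂ) :=
      Finset.prod_congr rfl fun n _ => by rw [← Complex.ofReal_exp, Real.exp_log (c.a_pos _)]
    have hP : (∏ n ∈ Finset.range N, (c.a (n + 1) : ℂ)) ≠ 0 :=
      Finset.prod_ne_zero_iff.2 fun n _ => c.a_ne_zero _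
    simp only [D]
    rw [Complex.exp_sub, Complex.exp_sub, Complex.exp_sum, Complex.exp_sum, Complex.exp_sum,
      e1, e2, e3, c.prod_sub_eig, mul_div_cancel_left₀ _ hP, div_self (c.fMinus_ne_zero hw N)]
  have hdiff : ∀ w ∈ upperHalf, DifferentiableAt ℂ D w := by
    intro w hw
    refine (DifferentiableAt.fun_sum fun n _ => (c.differentiableAt_ratioMinus hw n).clog
      (mem_slitPlane_of_im_pos (c.im_ratioMinus_pos hw n))).sub
      ((DifferentiableAt.fun_sum fun i _ => ?_).sub (differentiableAt_const _))
    exact (differentiableAt_id.sub_const _).clog (mem_slitPlane_of_im_pos (him w hw i))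
  -- Differentiating $e^D=1$ gives $D'=0$.
  have hderiv : Set.EqOn (deriv D) 0 upperHalf := by
    intro w hw
    have h1 := (hdiff w hw).hasDerivAt.cexp
    have h2 : (fun x => Complex.exp (D x)) =ᶠ[𝓝 w] fun _ => 1 :=
      (isOpen_upperHalf.eventually_mem hw).mono hexp
    have h3 := (h1.congr_of_eventuallyEq h2.symm).unique (hasDerivAt_const w (1 : ℂ))
    rw [hexp w hw, one_mul] at h3
    exact h3
  have hconn : IsPreconnected upperHalf := (convex_halfSpace_im_gt 0).isPreconnected
  obtain ⟨d, hd⟩ := isOpen_upperHalf.exists_is_const_of_deriv_eq_zero hconn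
    (fun w hw => (hdiff w hw).differentiableWithinAt) hderiv
  have hdre : d.re = 0 := by
    have h1 := congrArg norm (hexp z hz)
    rw [Complex.norm_exp, norm_one, Real.exp_eq_one_iff, hd z hz] at h1
    exact h1
  have hdim : d.im = 0 := by
    have h1 : Tendsto (fun y : ℝ => (D (Complex.I * y)).im) atTop
        (𝓝 (∑ _n ∈ Finset.range N, Real.pi / 2 - ∑ _i : Fin N, Real.pi / 2)) := by
      have e : ∀ y : ℝ, (D (Complex.I * y)).im
          = ∑ n ∈ Finset.range N, (c.fMinus (n + 2) (Complex.I * y)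
              / c.fMinus (n + 1) (Complex.I * y)).arg
            - ∑ i, (Complex.I * y - c.eig N i).arg := by
        intro y
        simp only [D, Complex.sub_im, Complex.im_sum, Complex.log_im, Complex.ofReal_im,
          Finset.sum_const_zero, sub_zero]
      simp only [e]
      refine (tendsto_finsetSum _ fun n _ => c.tendsto_arg_ratioMinus n).sub
        (tendsto_finsetSum _ fun i _ => tendsto_arg_of_div one_pos ?_)
      have h := (tendsto_const_nhds (x := Complex.I)).sub (tendsto_ofReal_inv_atTop.mul_const
        (c.eig N i : ℂ))
      rw [zero_mul, sub_zero] at h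
      rw [Complex.ofReal_one, one_mul]
      refine h.congr' ?_
      filter_upwards [eventually_gt_atTop 0] with y hy
      have : (y : ℂ) ≠ 0 := Complex.ofReal_ne_zero.2 hy.ne'
      push_cast
      field_simp
    have h2 : Tendsto (fun y : ℝ => (D (Complex.I * y)).im) atTop (𝓝 d.im) := by
      refine tendsto_const_nhds.congr' ?_
      filter_upwards [eventually_gt_atTop 0] with y hy
      rw [hd _ (I_mul_ofReal_mem hy)]
    have h3 := tendsto_nhds_unique h2 h1
    rw [h3]
    simp
  have h0 : D z = 0 := (hd z hz).trans (Complex.ext hdre hdim)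
  exact sub_eq_zero.1 h0

theorem wMinus_eq_sum_log {z : ℂ} (hz : z ∈ upperHalf) (N : ℕ) : c.wMinus N z
    = (N : ℂ)⁻¹ * ∑ i, Complex.log (z - c.eig N i) - c.meanLogA N := by
  rw [wMinus_eq, c.sum_log_ratioMinus hz, meanLogA]
  push_cast
  ring

theorem hasDerivAt_wMinus {z : ℂ} (hz : z ∈ upperHalf) (N : ℕ) :
    HasDerivAt (c.wMinus N) (-stieltjes (c.kN N) z) z := by
  have h1 : HasDerivAt (fun z => (N : ℂ)⁻¹ * ∑ i, Complex.log (z - c.eig N i) - c.meanLogA N)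
      ((N : ℂ)⁻¹ * ∑ i, 1 / (z - c.eig N i)) z := by
    refine (HasDerivAt.const_mul _ (HasDerivAt.fun_sum fun i _ => ?_)).sub_const _
    refine ((hasDerivAt_id z).sub_const _).clog (mem_slitPlane_of_im_pos ?_)
    rw [id, sub_ofReal_im]; exact hz
  have h2 : ((N : ℂ)⁻¹ * ∑ i, 1 / (z - c.eig N i)) = -stieltjes (c.kN N) z := by
    rw [stieltjes, integral_kN, Complex.real_smul, ← mul_neg, ← Finset.sum_neg_distrib]
    push_cast
    congr 1
    refine Finset.sum_congr rfl fun i _ => ?_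
    rw [one_div, ← inv_neg, neg_sub]
  rw [← h2]
  exact h1.congr_of_eventuallyEq ((isOpen_upperHalf.eventually_mem hz).mono fun w hw =>
    c.wMinus_eq_sum_log hw N)

theorem geomMean_eq (N : ℕ) :
    (∏ n ∈ Finset.Icc 1 N, c.a n) ^ (1 / (N : ℝ)) = Real.exp (c.meanLogA N) := by
  have hpos : 0 < ∏ n ∈ Finset.Icc 1 N, c.a n := Finset.prod_pos fun n _ => c.a_pos n
  rw [Real.rpow_def_of_pos hpos, Real.log_prod fun n _ => (c.a_pos n).ne',
    sum_Icc_one_eq_sum_range fun n => Real.log (c.a n), meanLogA, one_div, mul_comm]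

theorem condA_iff (N : ℕ → ℕ) :
    c.CondA N ↔ ∃ l : ℝ, Tendsto (fun j => c.meanLogA (N j)) atTop (𝓝 l) := by
  simp only [CondA, geomMean_eq]
  constructor
  · rintro ⟨A, hA, h⟩
    refine ⟨Real.log A, ((Real.continuousAt_log hA.ne').tendsto.comp h).congr fun j => ?_⟩
    exact Real.log_exp _
  · rintro ⟨l, h⟩
    exact ⟨Real.exp l, Real.exp_pos l, (Real.continuous_exp.tendsto l).comp h⟩

/-! ### Reduction of the conditions to pointwise convergence of Stieltjes transforms -/

section Convergence

variable {N : ℕ → ℕ}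

theorem eventually_isProbOn_kN (hN : Tendsto N atTop atTop) :
    ∃ M, ∀ᶠ j in atTop, IsProbOn M (c.kN (N j)) := by
  obtain ⟨M, -, hM⟩ := c.exists_abs_eig_le
  exact ⟨M, (hN.eventually_ge_atTop 1).mono fun j hj => c.isProbOn_kN hM hj⟩

theorem eventually_isProbOn_nuN (hN : Tendsto N atTop atTop) :
    ∀ᶠ j in atTop, IsProbOn (‖c.J‖ + 1) (c.nuN (N j)) :=
  (hN.eventually_ge_atTop 1).mono fun _ hj => c.isProbOn_nuN hj

theorem tendsto_gN_sub_stieltjes_kN (hN : Tendsto N atTop atTop) {z : ℂ} (hz : z ∈ upperHalf) :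
    Tendsto (fun j => c.gN (N j) z - stieltjes (c.kN (N j)) z) atTop (𝓝 0) := by
  simpa only [c.stieltjes_kN hz, sub_neg_eq_add] using c.tendsto_gN_add_logDeriv hN hz

theorem condN_iff (hN : Tendsto N atTop atTop) : c.CondN N ↔
    ∀ z ∈ upperHalf, ∃ l, Tendsto (fun j => stieltjes (c.kN (N j)) z) atTop (𝓝 l) := by
  constructor
  · rintro ⟨ν, hν, h⟩ z hz
    have h1 := h.tendsto_stieltjes (c.eventually_isProbOn_nuN hN) hz
    simp only [c.stieltjes_nuN hz] at h1
    refine ⟨_, (h1.sub (c.tendsto_gN_sub_stieltjes_kN hN hz)).congr fun j => ?_⟩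
    rw [sub_sub_cancel]
  · intro h
    refine exists_convWeakStar (c.eventually_isProbOn_nuN hN) fun z hz => ?_
    obtain ⟨l, hl⟩ := h z hz
    refine ⟨_, (hl.add (c.tendsto_gN_sub_stieltjes_kN hN hz)).congr fun j => ?_⟩
    rw [add_sub_cancel, c.stieltjes_nuN hz]

theorem condK_iff (hN : Tendsto N atTop atTop) : c.CondK N ↔
    ∀ z ∈ upperHalf, ∃ l, Tendsto (fun j => stieltjes (c.kN (N j)) z) atTop (𝓝 l) := by
  obtain ⟨M, hM⟩ := c.eventually_isProbOn_kN hN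
  constructor
  · rintro ⟨ν, hν, h⟩ z hz
    exact ⟨_, h.tendsto_stieltjes hM hz⟩
  · exact exists_convWeakStar hM

theorem condG_iff (hN : Tendsto N atTop atTop) : c.CondG N ↔
    ∀ z ∈ upperHalf, ∃ l, Tendsto (fun j => stieltjes (c.kN (N j)) z) atTop (𝓝 l) := by
  constructor
  · rintro ⟨g, -, h⟩ z hz
    refine ⟨_, ((h.tendsto hz).sub (c.tendsto_gN_sub_stieltjes_kN hN hz)).congr fun j => ?_⟩
    rw [sub_sub_cancel]
  · intro h
    -- Passing through the limit measure makes the limit of $g_{N_j}$ a Stieltjes transform, hence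
    -- Herglotz.
    obtain ⟨ν, hν, hconv⟩ := (c.condN_iff hN).2 h
    refine ⟨stieltjes ν, isHerglotz_stieltjes, convOnCompacts_of_lipschitz (fun ε hε => ?_)
      fun z hz => ?_⟩
    · refine ⟨(ε ^ 2)⁻¹, (c.eventually_isProbOn_nuN hN).mono fun j hj z w hz hw => ?_⟩
      have := hj.1
      rw [← c.stieltjes_nuN (hε.trans_le hz), ← c.stieltjes_nuN (hε.trans_le hw)]
      exact norm_stieltjes_sub_le hε hz hw
    · simpa only [c.stieltjes_nuN hz] using
        hconv.tendsto_stieltjes (c.eventually_isProbOn_nuN hN) hz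

/-- For fixed $z$ the function $t\mapsto\ln(z-t)$ is continuous on the line, so its integrals
against $k_{N_j}$ converge. -/
theorem exists_tendsto_mean_log (hN : Tendsto N atTop atTop)
    (h : ∀ z ∈ upperHalf, ∃ l, Tendsto (fun j => stieltjes (c.kN (N j)) z) atTop (𝓝 l))
    {z : ℂ} (hz : z ∈ upperHalf) :
    ∃ l, Tendsto (fun j => (N j : ℂ)⁻¹ * ∑ i, Complex.log (z - c.eig (N j) i)) atTop (𝓝 l) := by
  obtain ⟨M, hM⟩ := c.eventually_isProbOn_kN hN
  have hcont : Continuous fun t : ℝ => Complex.log (z - t) :=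
    Continuous.clog (by fun_prop) fun t => mem_slitPlane_of_im_pos (by rw [sub_ofReal_im]; exact hz)
  obtain ⟨l₁, h₁⟩ := exists_tendsto_integral hM h
    (Complex.continuous_re.comp hcont).continuousOn
  obtain ⟨l₂, h₂⟩ := exists_tendsto_integral hM h
    (Complex.continuous_im.comp hcont).continuousOn
  refine ⟨l₁ + l₂ * Complex.I, (((Complex.continuous_ofReal.tendsto _).comp h₁).add
    (((Complex.continuous_ofReal.tendsto _).comp h₂).mul_const Complex.I)).congr fun j => ?_⟩
  simp only [Function.comp_apply, integral_kN, smul_eq_mul]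
  rw [← Complex.re_add_im ((N j : ℂ)⁻¹ * ∑ i, Complex.log (z - c.eig (N j) i))]
  have e : (N j : ℂ)⁻¹ = (((N j : ℝ)⁻¹ : ℝ) : ℂ) := by push_cast; rfl
  rw [e, Complex.re_ofReal_mul, Complex.im_ofReal_mul, Complex.re_sum, Complex.im_sum]

/-- Weierstrass: derivatives converge as well, and $(w_-^{(N)})'$ is minus the transform of $k_N$,
the mean of $\ln a$ being constant in $z$. -/
theorem tendsto_stieltjes_of_condWM (h : c.CondWM N) :
    ∀ z ∈ upperHalf, ∃ l, Tendsto (fun j => stieltjes (c.kN (N j)) z) atTop (𝓝 l) := by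
  obtain ⟨w, -, hw⟩ := h
  intro z hz
  have h1 := hw.tendstoLocallyUniformlyOn.deriv
    (Eventually.of_forall fun j => c.differentiableOn_wMinus (N j)) isOpen_upperHalf
  refine ⟨_, (h1.tendsto_at hz).neg.congr fun j => ?_⟩
  rw [Function.comp_apply, (c.hasDerivAt_wMinus hz (N j)).deriv, neg_neg]

/-- In the Thouless formula at the single point $z=i$ two of the three terms converge, hence so does
the mean of $\ln a$. -/
theorem condA_of_condWM (hN : Tendsto N atTop atTop) (h : c.CondWM N) : c.CondA N := by
  have hz : Complex.I ∈ upperHalf := by simp [upperHalf]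
  obtain ⟨l, hl⟩ := c.exists_tendsto_mean_log hN (c.tendsto_stieltjes_of_condWM h) hz
  obtain ⟨w, -, hw⟩ := h
  refine (c.condA_iff N).2 ⟨_, ((Complex.continuous_re.tendsto _).comp
    (hl.sub (hw.tendsto hz))).congr fun j => ?_⟩
  rw [Function.comp_apply, c.wMinus_eq_sum_log hz, sub_sub_cancel, Complex.ofReal_re]

theorem condWM_of_condA (hN : Tendsto N atTop atTop) (hA : c.CondA N)
    (h : ∀ z ∈ upperHalf, ∃ l, Tendsto (fun j => stieltjes (c.kN (N j)) z) atTop (𝓝 l)) :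
    c.CondWM N := by
  obtain ⟨L, hL⟩ := (c.condA_iff N).1 hA
  have hlim : ∀ z ∈ upperHalf, ∃ l, Tendsto (fun j => c.wMinus (N j) z) atTop (𝓝 l) := by
    intro z hz
    obtain ⟨l, hl⟩ := c.exists_tendsto_mean_log hN h hz
    simp only [c.wMinus_eq_sum_log hz]
    exact ⟨_, hl.sub ((Complex.continuous_ofReal.tendsto _).comp hL)⟩
  choose! w hw using hlim
  obtain ⟨M, hM⟩ := c.eventually_isProbOn_kN hN
  have hconv : ConvOnCompacts (fun j => c.wMinus (N j)) w := by
    -- The derivative of $w_-^{(N)}$ is at most $1/\varepsilon$ on the convex set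
    -- $\operatorname{Im}z\ge\varepsilon$, uniformly in large $j$.
    refine convOnCompacts_of_lipschitz (fun ε hε => ⟨ε⁻¹, hM.mono fun j hj z v hz hv => ?_⟩) hw
    have := hj.1
    refine (convex_halfSpace_im_ge ε).norm_image_sub_le_of_norm_hasDerivWithin_le
      (f := c.wMinus (N j)) (f' := fun z => -stieltjes (c.kN (N j)) z)
      (fun u hu => (c.hasDerivAt_wMinus (hε.trans_le hu) (N j)).hasDerivWithinAt)
      (fun u hu => ?_) hv hz
    rw [norm_neg]
    exact (norm_stieltjes_le (hε.trans_le hu)).trans (inv_anti₀ hε hu)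
  exact ⟨w, (c.isHerglotz_of_wMinus hN hconv).1, hconv⟩

end Convergence

end JacobiCoeff

end JacobiDOS

theorem theorem3p1 (c : JacobiDOS.JacobiCoeff) (N : ℕ → ℕ) (hN : Tendsto N atTop atTop) :
    (c.CondWP N ↔ c.CondWM N) ∧
    (c.CondG N ↔ c.CondN N) ∧
    (c.CondN N ↔ c.CondK N) ∧
    (c.CondWP N ∨ c.CondWM N → c.CondG N ∧ c.CondN N ∧ c.CondK N ∧ c.CondA N) ∧
    (c.CondA N → c.CondG N ∨ c.CondN N ∨ c.CondK N → c.CondWP N ∧ c.CondWM N) := by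
  have hW := c.condWP_iff_condWM hN
  have hGiff := c.condG_iff hN
  have hNiff := c.condN_iff hN
  have hKiff := c.condK_iff hN
  refine ⟨hW, hGiff.trans hNiff.symm, hNiff.trans hKiff.symm, fun h => ?_, fun hA h => ?_⟩
  · rw [hW, or_self] at h
    have hS := c.tendsto_stieltjes_of_condWM h
    exact ⟨hGiff.2 hS, hNiff.2 hS, hKiff.2 hS, c.condA_of_condWM hN h⟩
  · rw [hGiff, hNiff, hKiff, or_self, or_self] at h
    have hWM := c.condWM_of_condA hN hA h
    exact ⟨hW.2 hWM, hWM⟩
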